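/- For $n\ge 1$ and a set $C\subseteq\mathbb Z_n\setminus\{0\}$ put $\overline C=\{c\in C: -c\notin C\}$. The mixed circulant graph $G(\mathbb Z_n,C)$ has vertex set $\mathbb Z_n$, an undirected edge $\{a,b\}$ whenever $b-a\in C\setminus\overline C$, and an arc $(a,b)$ whenever $b-a\in\overline C$. The Hermitian adjacency matrix $H_\Gamma=(h_{uv})$ of a mixed graph $\Gamma$ has $h_{uv}=1$ if $\{u,v\}$ is an edge, $h_{uv}=\mathrm i$ if $(u,v)$ is an arc, $h_{uv}=-\mathrm i$ if $(v,u)$ is an arc, and $h_{uv}=0$ otherwise. $\Gamma$ has perfect state transfer (PST) between $u$ and $v$ if $\exp(\mathrm i tH_\Gamma)\mathbf e_u=\gamma\mathbf e_v$ for some $t\in\mathbb R$ and some $\gamma\in\mathbb C$ with $|\gamma|=1$ (this is symmetric in $u$ and $v$). For $d\mid n$ let $G_n(d)=\{1\le k\le n-1:\gcd(k,n)=d\}$ and $G_n^{\pm1}(d)=\{k\in G_n(d): k/d\equiv\pm1 \pmod 4\}$. Let $B\subseteq\{d: d\mid n,\ 1\le d<n\}$, let $D\subseteq\{d\ge 1: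 4d\mid n\}$ (so $D=\emptyset$ if $4\nmid n$) with $B\cap D=\emptyset$, and let $\sigma:D\to\{1,-1\}$. The integral mixed circulant graph $\mathrm{IMCG}_n(B,D,\sigma)$ is $G(\mathbb Z_n,C)$ with $C=\bigcup_{d\in B}G_n(d)\cup\bigcup_{d\in D}G_n^{\sigma(d)}(d)$. For $i\ge 0$ let $B_i$ (resp. $D_i$) be the set of $d\in B$ (resp. $d\in D$) for which $2^i$ is the exact power of $2$ dividing $n/d$. For $i\in\{1,2,3\}$ let $B^*_i=B_i\setminus\{n/2^i\}$. For an integer $k$ and a set $A$ of integers write $kA=\{ka:a\in A\}$. **Theorem.** Let $\Gamma=\mathrm{IMCG}_n(B,D,\sigma)$, and assume that it is not the case that both $n\equiv 2\pmod 4$ and $B=\{n/2\}$ (i.e. $\Gamma$ is not a disjoint union of an odd number of copies of $K_2$). Then $n$ is even and $\Gamma$ has PST between $b+n/2$ and $b$ for every $b\in\mathbb Z_n$ if and only if $B_0=2B^*_1=4B^*_2$ and one of the following holds: (i) $n\equiv0\pmod 4$, $D_2=\{n/4\}$ and $n/2\notin B$; (ii) $n\equiv0\pmod 4$, $D_2=\emptyset$,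 and exactly one of $n/2$ and $n/4$ belongs to $B$; (iii) $n\equiv0\pmod 8$, $D_2=\emptyset$, $\{n/4,n/2\}\subseteq B$, $D_3=\{n/8\}$ and $B^*_2=2B^*_3$. -/

import Mathlib

/-- A (simple) mixed graph: symmetric irreflexive undirected edges and directed arcs; between two
vertices there is at most one of: an undirected edge, an arc one way, an arc the other way. -/
structure MixedGraph (V : Type*) where
  /-- `edge u v`: `{u, v}` is an undirected edge. -/
  edge : V → V → Prop
  /-- `arc u v`: `(u, v)` is a directed edge. -/
  arc : V → V → Prop
  edge_symm : ∀ u v, edge u v → edge v u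
  edge_irrefl : ∀ u, ¬ edge u u
  arc_asymm : ∀ u v, arc u v → ¬ arc v u
  edge_not_arc : ∀ u v, edge u v → ¬ arc u v

namespace MixedGraph

variable {V : Type*}

open Classical in
/-- The Hermitian adjacency matrix. -/
noncomputable def hermitianAdj (Γ : MixedGraph V) : Matrix V V ℂ :=
  Matrix.of fun u v =>
    if Γ.edge u v then 1
    else if Γ.arc u v then Complex.I
    else if Γ.arc v u then -Complex.I
    else 0

/-- The transition matrix `U(t) = exp(i t H)`. -/
noncomputable def transition [Fintype V] [DecidableEq V] (Γ : MixedGraph V) (t : ℝ) :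
    Matrix V V ℂ :=
  NormedSpace.exp ((Complex.I * (t : ℂ)) • Γ.hermitianAdj)

/-- Perfect state transfer from `u` to `v`: `U(t) e_u = γ e_v` for some real `t` and some
unimodular `γ`. (As `t` may be negative, this relation is symmetric in `u` and `v`.) -/
def HasPST [Fintype V] [DecidableEq V] (Γ : MixedGraph V) (u v : V) : Prop :=
  ∃ (t : ℝ) (γ : ℂ), ‖γ‖ = 1 ∧
    Matrix.mulVec (Γ.transition t) (Pi.single u (1 : ℂ)) = γ • (Pi.single v (1 : ℂ) : V → ℂ)

end MixedGraph

/-- The elements `c` of `C` with `-c ∉ C`. -/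
def orientedPart {n : ℕ} (C : Set (ZMod n)) : Set (ZMod n) := {c | c ∈ C ∧ -c ∉ C}

/-- The mixed circulant graph `G(ℤ_n, C)`, for a connection set `C` not containing `0`. -/
def mixedCirculant {n : ℕ} (C : Set (ZMod n)) (h0 : (0 : ZMod n) ∉ C) : MixedGraph (ZMod n) where
  edge a b := b - a ∈ C \ orientedPart C
  arc a b := b - a ∈ orientedPart C
  edge_symm := by
    rintro u v ⟨h1, h2⟩
    have h3 : -(v - u) ∈ C := by
      by_contra h
      exact h2 ⟨h1, h⟩
    rw [neg_sub] at h3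
    refine ⟨h3, fun h => h.2 ?_⟩
    rwa [neg_sub]
  edge_irrefl := by
    rintro u ⟨h1, -⟩
    rw [sub_self] at h1
    exact h0 h1
  arc_asymm := by
    intro u v h1 h2
    apply h1.2
    rw [neg_sub]
    exact h2.1
  edge_not_arc := fun _ _ h1 h2 => h1.2 h2

/-- `G_n(d) = {1 ≤ k ≤ n - 1 : gcd(k, n) = d}`, as a subset of `ℤ_n`. -/
def gcdClass (n d : ℕ) : Set (ZMod n) := {k | 1 ≤ k.val ∧ Nat.gcd k.val n = d}

/-- `G_n^r(d) = d · G_{n/d}^r(1)`: the `k = d m` in `G_n(d)` with `m ≡ r (mod 4)`. -/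
def gcdClassMod (n d : ℕ) (r : ℤ) : Set (ZMod n) :=
  {k | k ∈ gcdClass n d ∧ ∃ m : ℕ, k.val = d * m ∧ (m : ℤ) ≡ r [ZMOD 4]}

/-- The connection set of `IMCG_n(B, D, σ)`. A sign `-1` selects the residue `-1 ≡ 3 (mod 4)`. -/
def imcgSet (n : ℕ) (B D : Finset ℕ) (σ : {d // d ∈ D} → ℤˣ) : Set (ZMod n) :=
  (⋃ d ∈ B, gcdClass n d) ∪ ⋃ d : {d // d ∈ D}, gcdClassMod n d.1 (σ d : ℤ)

theorem zero_notMem_imcgSet (n : ℕ) (B D : Finset ℕ) (σ : {d // d ∈ D} → ℤˣ) :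
    (0 : ZMod n) ∉ imcgSet n B D σ := by
  simp [imcgSet, gcdClassMod, gcdClass]

/-- The mixed circulant graph `IMCG_n(B, D, σ)`. -/
def imcg (n : ℕ) (B D : Finset ℕ) (σ : {d // d ∈ D} → ℤˣ) : MixedGraph (ZMod n) :=
  mixedCirculant (imcgSet n B D σ) (zero_notMem_imcgSet n B D σ)

/-- `A_i`: the `d` in `A` such that the exact power of `2` dividing `n / d` is `2 ^ i`. -/
def layer (n : ℕ) (A : Finset ℕ) (i : ℕ) : Finset ℕ :=
  A.filter fun d => padicValNat 2 (n / d) = i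

/-- `A*_i = A_i \ {n / 2 ^ i}`. (If `2 ^ i` does not divide `n`, then for sets `A` of divisors of
`n` the layer `A_i` is empty and nothing is removed.) -/
def layerStar (n : ℕ) (A : Finset ℕ) (i : ℕ) : Finset ℕ := layer n A i \ {n / 2 ^ i}

/-- `k A = {k a : a ∈ A}`. -/
def dilate (k : ℕ) (A : Finset ℕ) : Finset ℕ := A.image fun a => k * a

/-! The Fourier transform diagonalises a circulant matrix, so transfer from `b + n/2` to `b` at time
`t` means that `exp(itΛ_j)(-1)^j` does not depend on `j`, where `Λ_j` are the eigenvalues. These are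
integers, and such a `t` exists iff for some `v` one has `Λ_j ≡ Λ_0 + 2^v j` modulo `2^(v+1)` for
all `j` (`exists_time_iff`).

Write `n = 2^e m` with `m` odd. By the Chinese remainder theorem `Λ_j` is a sum over the layers `a =
0, ..., e` of 2-power Ramanujan sums (plain for `B`, twisted by the character modulo 4 for `D`)
times transforms `F a`, `K a` on `ℤ_m` of the functions recording which `2^(e-a) gcd(x, m)` lie in
`B` and, with signs, in `D` (`sum_imcgCoeff_mul_stdAddChar`). The Ramanujan sums see `j` only
2-adically and the transforms see it only modulo `m`, so the two vary independently; modulo 8 only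
the layers 0 to 3 matter.

Since `m` is odd, a function on `ℤ_m` whose transform is constant modulo a power of 2 is divisible
by that power away from 0 (`IsFourierTransform.dvd_of_modEq`). The functions take values in `{0, 1,
-1}`, so these divisibilities become equalities: away from `x = 0` they give the equalities of
starred layers and the emptiness of the proper part of `D_2`. The values at `x = 0`, which encode
membership of `n/2^a`, decide between the three alternatives; the first two belong to `v = 1`, the
last to `v = 2` (`layerCondition_of_phase`, `phase_of_layerCondition`). -/

/-! ### Diagonalisation of circulant matrices and state transfer. -/

theorem Matrix.mulVec_exp_of_semiconj {ι : Type*} [Fintype ι] [DecidableEq ι]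
    {P H : Matrix ι ι ℂ} {μ : ι → ℂ} (h : P * H = Matrix.diagonal μ * P) (s : ℂ) :
    P * NormedSpace.exp (s • H) = Matrix.diagonal (fun i => Complex.exp (s * μ i)) * P := by
  let _ : NormedRing (Matrix ι ι ℂ) := Matrix.linftyOpNormedRing
  let _ : NormedAlgebra ℂ (Matrix ι ι ℂ) := Matrix.linftyOpNormedAlgebra
  let _ : NormedAlgebra ℚ (Matrix ι ι ℂ) := NormedAlgebra.restrictScalars ℚ ℂ _
  have h1 : SemiconjBy P (s • H) (Matrix.diagonal (s • μ)) := by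
    rw [SemiconjBy, Matrix.mul_smul, h, ← Matrix.smul_mul, Matrix.diagonal_smul]
  have h2 := h1.exp_right
  have h3 : NormedSpace.exp (Matrix.diagonal (s • μ)) =
      Matrix.diagonal (fun i => Complex.exp (s * μ i)) := by
    refine (Matrix.exp_diagonal (s • μ)).trans (congrArg _ (funext fun i => ?_))
    rw [Pi.exp_def, Complex.exp_eq_exp_ℂ]
    rfl
  exact h2.trans (congrArg (· * P) h3)

/-- The matrix of the discrete Fourier transform on `ZMod n`. -/
noncomputable def fourierMatrix (n : ℕ) [NeZero n] : Matrix (ZMod n) (ZMod n) ℂ :=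
  Matrix.of fun k u => ZMod.stdAddChar (-(u * k))

theorem fourierMatrix_mulVec_injective (n : ℕ) [NeZero n] :
    Function.Injective (fourierMatrix n).mulVec := by
  have : (fourierMatrix n).mulVec = (ZMod.dft : (ZMod n → ℂ) ≃ₗ[ℂ] (ZMod n → ℂ)) := by
    funext Φ k
    simp [fourierMatrix, Matrix.mulVec, dotProduct, ZMod.dft_apply]
  rw [this]
  exact LinearEquiv.injective _

theorem fourierMatrix_mul_circulant {n : ℕ} [NeZero n] (f : ZMod n → ℂ) :
    fourierMatrix n * (Matrix.of fun u v => f (v - u)) =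
      Matrix.diagonal (fun k => ∑ c, f c * ZMod.stdAddChar (c * k)) * fourierMatrix n := by
  ext k v
  rw [Matrix.diagonal_mul, Matrix.mul_apply, Finset.sum_mul]
  refine Fintype.sum_equiv (Equiv.subLeft v) _ _ fun u => ?_
  simp only [fourierMatrix, Matrix.of_apply, Equiv.subLeft_apply]
  rw [mul_comm, mul_assoc, ← AddChar.map_add_eq_mul]
  congr 2
  ring

/-- Compare the Fourier coefficients of both sides; injectivity of the Fourier matrix replaces its
inverse. -/
theorem transition_mulVec_single_iff {n : ℕ} [NeZero n] (Γ : MixedGraph (ZMod n))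
    (f : ZMod n → ℂ) (hf : ∀ u v, Γ.hermitianAdj u v = f (v - u)) (t : ℝ) (γ : ℂ)
    (u v : ZMod n) :
    Matrix.mulVec (Γ.transition t) (Pi.single u (1 : ℂ)) =
        γ • (Pi.single v (1 : ℂ) : ZMod n → ℂ) ↔
      ∀ k : ZMod n, Complex.exp (Complex.I * t * ∑ c, f c * ZMod.stdAddChar (c * k)) *
        ZMod.stdAddChar (-(u * k)) = γ * ZMod.stdAddChar (-(v * k)) := by
  have hH : Γ.hermitianAdj = Matrix.of fun u v => f (v - u) := by
    ext a b
    exact hf a b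
  have h := Matrix.mulVec_exp_of_semiconj (fourierMatrix_mul_circulant f) (Complex.I * t)
  rw [← (fourierMatrix_mulVec_injective n).eq_iff, MixedGraph.transition, hH,
    Matrix.mulVec_mulVec, h, funext_iff]
  refine forall_congr' fun k => ?_
  rw [Matrix.mulVec_single_one, Matrix.mulVec_smul, Matrix.mulVec_single_one]
  simp [Matrix.diagonal_mul, fourierMatrix]

theorem stdAddChar_half_mul {n : ℕ} [NeZero n] (hn : Even n) (j : ℤ) :
    ZMod.stdAddChar (-(((n / 2 : ℕ) : ZMod n) * (j : ZMod n))) = (-1 : ℂ) ^ j := by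
  have h1 : -(((n / 2 : ℕ) : ZMod n) * (j : ZMod n)) = ((-((n / 2 : ℕ) * j) : ℤ) : ZMod n) := by
    rw [Int.cast_neg, Int.cast_mul, Int.cast_natCast]
  obtain ⟨m, rfl⟩ := hn
  have hm : (m : ℂ) ≠ 0 := by
    have := NeZero.ne (m + m)
    exact_mod_cast fun h => this (by simp [h])
  have h2 : (m + m) / 2 = m := by omega
  rw [h1, ZMod.stdAddChar_coe, h2]
  have h3 : 2 * (Real.pi : ℂ) * Complex.I * ((-((m : ℤ) * j) : ℤ) : ℂ) / ((m + m : ℕ) : ℂ) =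
      (-j : ℤ) * (Real.pi * Complex.I) := by
    push_cast
    field_simp
    ring
  rw [h3, Complex.exp_int_mul, Complex.exp_pi_mul_I, zpow_neg, ← inv_zpow]
  norm_num

/-- The phase contributed by `b` cancels, and the shift by `n/2` leaves the sign `(-1)^j`; hence one
condition serves every `b`. -/
theorem forall_hasPST_iff {n : ℕ} [NeZero n] (hn : Even n) (Γ : MixedGraph (ZMod n))
    (f : ZMod n → ℂ) (hf : ∀ u v, Γ.hermitianAdj u v = f (v - u)) (Λ : ℤ → ℤ)
    (hΛ : ∀ j : ℤ, ∑ c, f c * ZMod.stdAddChar (c * (j : ZMod n)) = Λ j) :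
    (∀ b, Γ.HasPST (b + ((n / 2 : ℕ) : ZMod n)) b) ↔
      ∃ (t : ℝ) (γ : ℂ), ‖γ‖ = 1 ∧
        ∀ j : ℤ, Complex.exp (Complex.I * t * Λ j) * (-1) ^ j = γ := by
  have key : ∀ b t γ, Matrix.mulVec (Γ.transition t)
      (Pi.single (b + ((n / 2 : ℕ) : ZMod n)) (1 : ℂ)) =
        γ • (Pi.single b (1 : ℂ) : ZMod n → ℂ) ↔
      ∀ j : ℤ, Complex.exp (Complex.I * t * Λ j) * (-1) ^ j = γ := by
    intro b t γ
    rw [transition_mulVec_single_iff Γ f hf, (ZMod.intCast_surjective (n := n)).forall]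
    refine forall_congr' fun j => ?_
    rw [hΛ, add_mul, neg_add, AddChar.map_add_eq_mul, stdAddChar_half_mul hn]
    have h0 : (ZMod.stdAddChar (-(b * (j : ZMod n))) : ℂ) ≠ 0 := by
      rw [ZMod.stdAddChar_apply]
      exact Circle.coe_ne_zero _
    rw [mul_comm (ZMod.stdAddChar _), ← mul_assoc, mul_left_inj' h0]
  simp only [MixedGraph.HasPST, key, forall_const]

/-! ### From a transfer time to a 2-adic congruence. -/

/-- Equality of phases says that `t(Λ j - Λ 0)` is `π` times an integer of the parity of `j`.
Eliminating `t` by comparison with `j = 1` gives ratios with odd denominator, so `v` is the 2-adic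
valuation of `Λ 1 - Λ 0`. Conversely `t = π/2^v` works. -/
theorem exists_time_iff (Λ : ℤ → ℤ) :
    (∃ (t : ℝ) (γ : ℂ), ‖γ‖ = 1 ∧
        ∀ j : ℤ, Complex.exp (Complex.I * t * Λ j) * (-1) ^ j = γ) ↔
      ∃ v : ℕ, ∀ j : ℤ, Λ j ≡ Λ 0 + 2 ^ v * j [ZMOD 2 ^ (v + 1)] := by
  have hneg : ∀ j : ℤ, (-1 : ℂ) ^ j = Complex.exp (j * (Real.pi * Complex.I)) := by
    intro j
    rw [Complex.exp_int_mul, Complex.exp_pi_mul_I]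
  constructor
  · rintro ⟨t, γ, -, h⟩
    have h1 : ∀ j : ℤ, ∃ l : ℤ, t * (Λ j - Λ 0) = Real.pi * (j + 2 * l) := by
      intro j
      have h2 := (h j).trans (h 0).symm
      rw [hneg, hneg, ← Complex.exp_add, ← Complex.exp_add, Complex.exp_eq_exp_iff_exists_int] at h2
      obtain ⟨l, hl⟩ := h2
      -- The phases give `t(Λ j - Λ 0) + πj = 2πl`, and `2l - j = j + 2(l - j)`.
      refine ⟨l - j, ?_⟩
      have h3 : ((t * (Λ j - Λ 0) : ℝ) : ℂ) = ((Real.pi * (j + 2 * (l - j : ℤ)) : ℝ) : ℂ) := by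
        push_cast
        refine mul_left_cancel₀ Complex.I_ne_zero ?_
        push_cast at hl
        linear_combination hl
      exact_mod_cast h3
    choose l hl using h1
    have hc : ∀ j : ℤ, (Λ j - Λ 0) * (1 + 2 * l 1) = (Λ 1 - Λ 0) * (j + 2 * l j) := by
      intro j
      have ht : t * Real.pi ≠ 0 := by
        refine mul_ne_zero ?_ Real.pi_ne_zero
        rintro rfl
        have := hl 1
        rw [zero_mul, zero_eq_mul, or_iff_right Real.pi_ne_zero] at this
        have h4 : (1 : ℤ) + 2 * l 1 = 0 := by exact_mod_cast this
        omega
      have : ((Λ j - Λ 0) * (1 + 2 * l 1) : ℝ) = (Λ 1 - Λ 0) * (j + 2 * l j) := by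
        refine mul_left_cancel₀ ht ?_
        have h1 := hl 1
        have h2 := hl j
        push_cast at h1
        linear_combination Real.pi * (1 + 2 * (l 1 : ℝ)) * h2 - Real.pi * (j + 2 * (l j : ℝ)) * h1
      exact_mod_cast this
    have hne : Λ 1 - Λ 0 ≠ 0 := by
      intro h0
      have h1 := hl 1
      have h2 : ((Λ 1 : ℝ) - Λ 0) = 0 := by exact_mod_cast h0
      rw [h2, mul_zero, zero_eq_mul, or_iff_right Real.pi_ne_zero] at h1
      have h4 : (1 : ℤ) + 2 * l 1 = 0 := by exact_mod_cast h1
      omega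
    obtain ⟨v, o, ho, hv⟩ := (Int.finiteMultiplicity_iff.2
      ⟨by norm_num, hne⟩ : FiniteMultiplicity (2 : ℤ) (Λ 1 - Λ 0)).exists_eq_pow_mul_and_not_dvd
      |>.elim fun o h => (⟨_, o, h.2, h.1⟩ : ∃ (v : ℕ) (o : ℤ), ¬ 2 ∣ o ∧ Λ 1 - Λ 0 = 2 ^ v * o)
    refine ⟨v, fun j => ?_⟩
    have hcop : IsCoprime ((2 : ℤ) ^ v) (1 + 2 * l 1) :=
      IsCoprime.pow_left ⟨-l 1, 1, by ring⟩
    have hd : (2 : ℤ) ^ v ∣ Λ j - Λ 0 := by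
      refine hcop.dvd_of_dvd_mul_right ?_
      rw [hc j, hv, mul_assoc]
      exact dvd_mul_right _ _
    obtain ⟨z, hz⟩ := hd
    have h5 : z * (1 + 2 * l 1) = o * (j + 2 * l j) := by
      have := hc j
      rw [hz, hv, mul_assoc, mul_assoc] at this
      exact mul_left_cancel₀ (by positivity) this
    have h6 : (2 : ℤ) ∣ j - z := by
      obtain ⟨o', rfl⟩ : ∃ o', o = 2 * o' + 1 := ⟨o / 2, by omega⟩
      exact ⟨z * l 1 - o' * (j + 2 * l j) - l j, by linear_combination -h5⟩
    obtain ⟨q, hq⟩ := h6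
    refine Int.modEq_iff_dvd.2 ⟨q, ?_⟩
    rw [pow_succ]
    linear_combination 2 ^ v * hq - hz
  · rintro ⟨v, h⟩
    refine ⟨Real.pi / 2 ^ v, Complex.exp (Complex.I * (Real.pi / 2 ^ v : ℝ) * Λ 0), ?_, ?_⟩
    · rw [mul_assoc, mul_comm Complex.I, ← Complex.ofReal_intCast, ← Complex.ofReal_mul,
        Complex.norm_exp_ofReal_mul_I]
    · intro j
      obtain ⟨q, hq⟩ := Int.modEq_iff_dvd.1 (h j)
      rw [hneg, ← Complex.exp_add, Complex.exp_eq_exp_iff_exists_int]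
      refine ⟨j - q, ?_⟩
      have h2 : (Λ j : ℂ) = Λ 0 + 2 ^ v * j - 2 ^ (v + 1) * q := by
        have : Λ j = Λ 0 + 2 ^ v * j - 2 ^ (v + 1) * q := by linear_combination -hq
        rw [this]; push_cast; ring
      rw [h2]
      push_cast
      field_simp
      ring

/-! ### Roots of unity and integrality. -/

/-- The normalized exponential `z ↦ exp (2 π i z)`. -/
noncomputable def expTwoPiI (z : ℂ) : ℂ := Complex.exp (2 * Real.pi * Complex.I * z)

theorem expTwoPiI_add (x y : ℂ) : expTwoPiI (x + y) = expTwoPiI x * expTwoPiI y := by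
  rw [expTwoPiI, mul_add, Complex.exp_add, expTwoPiI, expTwoPiI]

theorem expTwoPiI_eq_one_iff (z : ℂ) : expTwoPiI z = 1 ↔ ∃ k : ℤ, z = k := by
  rw [expTwoPiI, Complex.exp_eq_one_iff]
  refine exists_congr fun k => ?_
  rw [mul_comm (k : ℂ), mul_right_inj' Complex.two_pi_I_ne_zero]

@[simp]
theorem expTwoPiI_intCast (k : ℤ) : expTwoPiI k = 1 :=
  (expTwoPiI_eq_one_iff _).2 ⟨k, rfl⟩

@[simp]
theorem expTwoPiI_zero : expTwoPiI 0 = 1 := by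
  simpa using expTwoPiI_intCast 0

theorem expTwoPiI_pow (z : ℂ) (k : ℕ) : expTwoPiI z ^ k = expTwoPiI (k * z) := by
  rw [expTwoPiI, ← Complex.exp_nat_mul, expTwoPiI]
  congr 1
  ring

theorem expTwoPiI_half : expTwoPiI (1 / 2) = -1 := by
  rw [expTwoPiI, ← Complex.exp_pi_mul_I]
  exact congrArg Complex.exp (by ring)

theorem expTwoPiI_quarter : expTwoPiI (1 / 4) = Complex.I := by
  rw [expTwoPiI, show 2 * (Real.pi : ℂ) * Complex.I * (1 / 4) = Real.pi / 2 * Complex.I by ring,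
    Complex.exp_pi_div_two_mul_I]

theorem expTwoPiI_div_eq_one_iff {N : ℕ} (hN : N ≠ 0) (j : ℤ) :
    expTwoPiI (j / N) = 1 ↔ (N : ℤ) ∣ j := by
  have hN' : (N : ℂ) ≠ 0 := by exact_mod_cast hN
  rw [expTwoPiI_eq_one_iff]
  refine exists_congr fun k => ?_
  rw [div_eq_iff hN', mul_comm]
  exact_mod_cast Iff.rfl

theorem sum_expTwoPiI_mul_div {N : ℕ} (hN : N ≠ 0) (j : ℤ) :
    ∑ t ∈ Finset.range N, expTwoPiI (j * t / N) = if (N : ℤ) ∣ j then (N : ℂ) else 0 := by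
  have hN' : (N : ℂ) ≠ 0 := by exact_mod_cast hN
  have h1 : ∀ t : ℕ, expTwoPiI (j * t / N) = expTwoPiI (j / N) ^ t := by
    intro t
    rw [expTwoPiI_pow]
    congr 1
    ring
  simp only [h1]
  split_ifs with h
  · simp [(expTwoPiI_div_eq_one_iff hN j).2 h]
  · have h2 := mt (expTwoPiI_div_eq_one_iff hN j).1 h
    rw [geom_sum_eq h2, expTwoPiI_pow, mul_div_cancel₀ _ hN', expTwoPiI_intCast]
    simp

theorem isIntegral_expTwoPiI_div {N : ℕ} (hN : N ≠ 0) (j : ℤ) :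
    IsIntegral ℤ (expTwoPiI (j / N)) := by
  have hN' : (N : ℂ) ≠ 0 := by exact_mod_cast hN
  refine IsIntegral.of_pow (Nat.pos_of_ne_zero hN) ?_
  rw [expTwoPiI_pow, mul_div_cancel₀ _ hN', expTwoPiI_intCast]
  exact isIntegral_one

/-- The quotient `a / M` is rational and an algebraic integer, hence an integer. -/
theorem Int.dvd_of_cast_eq_mul_isIntegral {a M : ℤ} (hM : M ≠ 0) {z : ℂ} (hz : IsIntegral ℤ z)
    (h : (a : ℂ) = M * z) : M ∣ a := by
  have hM' : (M : ℂ) ≠ 0 := by exact_mod_cast hM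
  have h1 : algebraMap ℚ ℂ (a / M) = z := by
    rw [eq_ratCast]
    push_cast
    rw [h]
    field_simp
  rw [← h1, isIntegral_algebraMap_iff (algebraMap ℚ ℂ).injective] at hz
  obtain ⟨k, hk⟩ := IsIntegrallyClosed.isIntegral_iff.1 hz
  refine ⟨k, ?_⟩
  rw [eq_intCast, eq_div_iff (by exact_mod_cast hM)] at hk
  have : k * M = a := by exact_mod_cast hk
  rw [← this, mul_comm]

/-! ### Integer-valued Fourier transforms modulo `m`. -/

/-- `W` is the (integer-valued) Fourier transform of the function `g` on `{0, …, m - 1}`. -/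
def IsFourierTransform (m : ℕ) (g : ℕ → ℤ) (W : ℤ → ℤ) : Prop :=
  ∀ w : ℤ, ∑ x ∈ Finset.range m, (g x : ℂ) * expTwoPiI (w * x / m) = W w

namespace IsFourierTransform

variable {m : ℕ} {g g' : ℕ → ℤ} {W W' : ℤ → ℤ}

theorem add (h : IsFourierTransform m g W) (h' : IsFourierTransform m g' W') :
    IsFourierTransform m (g + g') (W + W') := by
  intro w
  simp only [Pi.add_apply, Int.cast_add, add_mul, Finset.sum_add_distrib, h w, h' w]

theorem const_mul (c : ℤ) (h : IsFourierTransform m g W) :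
    IsFourierTransform m (fun x => c * g x) (fun w => c * W w) := by
  intro w
  simp only [Int.cast_mul, mul_assoc, ← Finset.mul_sum, h w]

theorem apply_eq_of_forall_pos (hm : m ≠ 0) (h : IsFourierTransform m g W)
    (hg : ∀ x, 0 < x → x < m → g x = 0) (w : ℤ) : W w = g 0 := by
  have h1 := h w
  rw [Finset.sum_eq_single 0] at h1
  · simp only [Nat.cast_zero, mul_zero, zero_div, expTwoPiI_zero, mul_one] at h1
    exact_mod_cast h1.symm
  · intro x hx hx0
    rw [hg x (Nat.pos_of_ne_zero hx0) (Finset.mem_range.1 hx)]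
    simp
  · intro h0
    exact absurd (Finset.mem_range.2 (Nat.pos_of_ne_zero hm)) h0

theorem inversion (hm : m ≠ 0) (h : IsFourierTransform m g W) {x : ℕ} (hx : x < m) :
    ∑ w ∈ Finset.range m, (W w : ℂ) * expTwoPiI (((-(w * x) : ℤ) : ℂ) / m) = m * g x := by
  have h1 : ∀ w : ℕ, (W w : ℂ) * expTwoPiI (((-(w * x) : ℤ) : ℂ) / m) =
      ∑ y ∈ Finset.range m, g y * expTwoPiI (((y - x : ℤ) : ℂ) * w / m) := by
    intro w
    rw [← h w, Finset.sum_mul]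
    refine Finset.sum_congr rfl fun y _ => ?_
    rw [mul_assoc, ← expTwoPiI_add]
    congr 2
    push_cast
    ring
  simp only [h1]
  rw [Finset.sum_comm]
  simp only [← Finset.mul_sum, sum_expTwoPiI_mul_div hm]
  rw [Finset.sum_eq_single x]
  · simp [mul_comm]
  · intro y hy hyx
    rw [if_neg, mul_zero]
    intro hd
    have hy' := Finset.mem_range.1 hy
    have := Int.eq_zero_of_abs_lt_dvd hd (by rw [abs_lt]; omega)
    omega
  · intro h0
    exact absurd (Finset.mem_range.2 hx) h0

/-- A function whose Fourier transform is constant modulo `M`, with `M` prime to the order of the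
group, vanishes modulo `M` away from `0`. -/
theorem dvd_of_modEq (hm : m ≠ 0) (h : IsFourierTransform m g W) {M : ℤ} (hM : M ≠ 0)
    (hcop : IsCoprime M m) {c : ℤ} (hW : ∀ w, W w ≡ c [ZMOD M]) {x : ℕ} (hx0 : 0 < x)
    (hx : x < m) : M ∣ g x := by
  choose q hq using fun w => Int.modEq_iff_dvd.1 (hW w).symm
  -- For `x ≠ 0` the constant `c` contributes nothing to the inversion formula.
  have h1 : ∑ w ∈ Finset.range m, expTwoPiI (((-(w * x) : ℤ) : ℂ) / m) = 0 := by
    have h2 := sum_expTwoPiI_mul_div hm (-x)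
    rw [if_neg] at h2
    · rw [← h2]
      refine Finset.sum_congr rfl fun w _ => ?_
      congr 1
      push_cast
      ring
    · intro hd
      have := Int.eq_zero_of_abs_lt_dvd hd (by rw [abs_lt]; omega)
      omega
  -- What remains exhibits `m * g x` as `M` times an algebraic integer; coprimality then removes
  -- `m`.
  have h2 : ((m * g x : ℤ) : ℂ) =
      M * ∑ w ∈ Finset.range m, (q w : ℂ) * expTwoPiI (((-(w * x) : ℤ) : ℂ) / m) := by
    have h3 := h.inversion hm hx
    push_cast at h3 ⊢
    rw [← h3, Finset.mul_sum]
    rw [← sub_zero (Finset.sum _ _), ← mul_zero (c : ℂ), ← h1, Finset.mul_sum,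
      ← Finset.sum_sub_distrib]
    refine Finset.sum_congr rfl fun w _ => ?_
    have h4 : (W w : ℂ) = c + M * q w := by
      have := hq w
      exact_mod_cast (by linear_combination this : W w = c + M * q w)
    rw [h4]
    push_cast
    ring
  refine hcop.dvd_of_dvd_mul_left (Int.dvd_of_cast_eq_mul_isIntegral hM ?_ h2)
  refine IsIntegral.sum _ fun w _ => IsIntegral.mul ?_ (isIntegral_expTwoPiI_div hm _)
  exact isIntegral_algebraMap (R := ℤ) (x := q w)

end IsFourierTransform

theorem sum_filter_dvd_expTwoPiI {m d : ℕ} (hm : m ≠ 0) (hd : d ∣ m) (w : ℤ) :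
    ∑ x ∈ Finset.range m with d ∣ x, expTwoPiI (w * x / m) =
      if ((m / d : ℕ) : ℤ) ∣ w then ((m / d : ℕ) : ℂ) else 0 := by
  obtain ⟨k, rfl⟩ := hd
  have hd0 : 0 < d := Nat.pos_of_ne_zero (left_ne_zero_of_mul hm)
  have hdc : (d : ℂ) ≠ 0 := by exact_mod_cast hd0.ne'
  rw [Nat.mul_div_cancel_left _ hd0, ← sum_expTwoPiI_mul_div (right_ne_zero_of_mul hm)]
  symm
  refine Finset.sum_bij (fun t _ => d * t) ?_ ?_ ?_ ?_
  · intro t ht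
    simp only [Finset.mem_filter, Finset.mem_range] at ht ⊢
    exact ⟨Nat.mul_lt_mul_of_pos_left ht hd0, dvd_mul_right _ _⟩
  · intro a _ b _ hab
    exact Nat.eq_of_mul_eq_mul_left hd0 hab
  · intro x hx
    simp only [Finset.mem_filter, Finset.mem_range] at hx
    obtain ⟨hx, t, rfl⟩ := hx
    exact ⟨t, Finset.mem_range.2 (Nat.lt_of_mul_lt_mul_left hx), rfl⟩
  · intro t _
    congr 1
    push_cast
    rw [show (w : ℂ) * (d * t) = d * (w * t) by ring, mul_div_mul_left _ _ hdc]

/-- Descending induction on `d`: the sum over all multiples of `d` is an integer, and it splits into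
the classes of the divisors `d'` with `d ∣ d'`, all larger than `d` except `d` itself. -/
theorem sum_filter_gcd_expTwoPiI_mem {m : ℕ} (hm : m ≠ 0) (w : ℤ) (d : ℕ) (hd : d ∣ m) :
    ∑ x ∈ Finset.range m with Nat.gcd x m = d, expTwoPiI (w * x / m) ∈
      (Int.castRingHom ℂ).range := by
  induction hk : m - d using Nat.strong_induction_on generalizing d with
  | _ k ih =>
    have h1 : ∑ x ∈ Finset.range m with d ∣ x, expTwoPiI (w * x / m) =
        ∑ d' ∈ m.divisors with d ∣ d', ∑ x ∈ Finset.range m with Nat.gcd x m = d',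
          expTwoPiI (w * x / m) := by
      rw [← Finset.sum_fiberwise_of_maps_to (t := m.divisors.filter (d ∣ ·))
        (g := fun x => Nat.gcd x m)]
      · refine Finset.sum_congr rfl fun d' hd' => ?_
        refine Finset.sum_congr ?_ fun _ _ => rfl
        ext x
        simp only [Finset.mem_filter]
        constructor
        · rintro ⟨⟨h1, -⟩, h2⟩
          exact ⟨h1, h2⟩
        · rintro ⟨h1, rfl⟩
          exact ⟨⟨h1, (Finset.mem_filter.1 hd').2.trans (Nat.gcd_dvd_left _ _)⟩, rfl⟩
      · intro x hx
        simp only [Finset.mem_filter, Nat.mem_divisors]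
        exact ⟨⟨Nat.gcd_dvd_right _ _, hm⟩, Nat.dvd_gcd (Finset.mem_filter.1 hx).2 hd⟩
    have hmem : d ∈ m.divisors.filter (d ∣ ·) := by simp [hd, hm]
    rw [← Finset.add_sum_erase _ _ hmem, sum_filter_dvd_expTwoPiI hm hd] at h1
    rw [eq_sub_of_add_eq h1.symm]
    refine Subring.sub_mem _ ?_ (Subring.sum_mem _ fun d' hd' => ?_)
    · split_ifs
      · exact ⟨((m / d : ℕ) : ℤ), by rw [eq_intCast, Int.cast_natCast]⟩
      · exact Subring.zero_mem _
    · simp only [Finset.mem_erase, Finset.mem_filter, Nat.mem_divisors] at hd'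
      obtain ⟨hne, ⟨hd'm, -⟩, hdd'⟩ := hd'
      have h2 := Nat.le_of_dvd (Nat.pos_of_ne_zero hm) hd'm
      have h3 := Nat.le_of_dvd (Nat.pos_of_dvd_of_pos hd'm (Nat.pos_of_ne_zero hm)) hdd'
      exact ih (m - d') (by omega) d' hd'm rfl

theorem exists_isFourierTransform_gcd {m : ℕ} (hm : m ≠ 0) (h : ℕ → ℤ) :
    ∃ W, IsFourierTransform m (fun x => h (Nat.gcd x m)) W := by
  suffices ∀ w : ℤ, ∃ z : ℤ, ∑ x ∈ Finset.range m,
      (h (Nat.gcd x m) : ℂ) * expTwoPiI (w * x / m) = z from ⟨_, fun w => (this w).choose_spec⟩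
  intro w
  have h1 : ∑ x ∈ Finset.range m, (h (Nat.gcd x m) : ℂ) * expTwoPiI (w * x / m) ∈
      (Int.castRingHom ℂ).range := by
    rw [← Finset.sum_fiberwise_of_maps_to (t := m.divisors) (g := fun x => Nat.gcd x m)
      (fun x _ => Nat.mem_divisors.2 ⟨Nat.gcd_dvd_right _ _, hm⟩)]
    refine Subring.sum_mem _ fun d hd => ?_
    have h2 : ∀ x ∈ (Finset.range m).filter (fun x => Nat.gcd x m = d),
        (h (Nat.gcd x m) : ℂ) * expTwoPiI (w * x / m) = h d * expTwoPiI (w * x / m) := by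
      intro x hx
      rw [(Finset.mem_filter.1 hx).2]
    rw [Finset.sum_congr rfl h2, ← Finset.mul_sum]
    exact Subring.mul_mem _ ⟨h d, rfl⟩
      (sum_filter_gcd_expTwoPiI_mem hm w d (Nat.dvd_of_mem_divisors hd))
  obtain ⟨z, hz⟩ := h1
  exact ⟨z, hz.symm⟩

/-! ### Ramanujan sums of 2-power order. -/

theorem Finset.sum_range_two_mul {M : Type*} [AddCommMonoid M] (f : ℕ → M) (N : ℕ) :
    ∑ t ∈ Finset.range (2 * N), f t = ∑ s ∈ Finset.range N, (f (2 * s) + f (2 * s + 1)) := by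
  induction N with
  | zero => simp
  | succ N ih =>
    rw [show 2 * (N + 1) = 2 * N + 1 + 1 by ring, Finset.sum_range_succ, Finset.sum_range_succ,
      ih, Finset.sum_range_succ, add_assoc]

/-- Elements of `ℤ_{2^e}` are sorted by their additive order, `1` or `2^(b+1)`. -/
theorem Finset.sum_range_two_pow {M : Type*} [AddCommMonoid M] (G : ℕ → M) (e : ℕ) :
    ∑ y ∈ Finset.range (2 ^ e), G y = G 0 + ∑ b ∈ Finset.range e,
      ∑ t ∈ Finset.range (2 ^ b), G (2 ^ (e - (b + 1)) * (2 * t + 1)) := by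
  induction e generalizing G with
  | zero => simp
  | succ e ih =>
    rw [pow_succ', Finset.sum_range_two_mul, Finset.sum_add_distrib, ih (fun y => G (2 * y)),
      Finset.sum_range_succ, add_assoc]
    congr 2
    · refine Finset.sum_congr rfl fun b hb => Finset.sum_congr rfl fun t _ => ?_
      have := Finset.mem_range.1 hb
      rw [show e + 1 - (b + 1) = e - (b + 1) + 1 by omega, pow_succ', mul_assoc]
    · simp

/-- The Ramanujan sum of order `2 ^ (b + 1)`. -/
def ramanujanTwoPow (b : ℕ) (j : ℤ) : ℤ :=
  if (2 : ℤ) ^ (b + 1) ∣ j then 2 ^ b else if (2 : ℤ) ^ b ∣ j then -2 ^ b else 0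

/-- `i` times the Ramanujan sum of order `2 ^ (b + 1)` twisted by the character modulo `4`,
for `b ≥ 1`. -/
def twistedRamanujanTwoPow (b : ℕ) (j : ℤ) : ℤ :=
  if (2 : ℤ) ^ (b - 1) ∣ j then -2 ^ b * ZMod.χ₄ ((j / 2 ^ (b - 1) : ℤ) : ZMod 4) else 0

/-- Without the common factor `expTwoPiI (j / 2 ^ (b + 1))` the sum is geometric; it survives only
for `2^b ∣ j`, where that factor is `±1`. -/
theorem sum_expTwoPiI_odd (b : ℕ) (j : ℤ) :
    ∑ t ∈ Finset.range (2 ^ b), expTwoPiI (j * (2 * t + 1 : ℕ) / (2 : ℂ) ^ (b + 1)) =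
      ramanujanTwoPow b j := by
  have h1 : ∀ t : ℕ, expTwoPiI (j * (2 * t + 1 : ℕ) / (2 : ℂ) ^ (b + 1)) =
      expTwoPiI (j / 2 ^ (b + 1)) * expTwoPiI (j * t / (2 ^ b : ℕ)) := by
    intro t
    rw [← expTwoPiI_add]
    congr 1
    push_cast
    field_simp
    ring
  simp only [h1]
  rw [← Finset.mul_sum, sum_expTwoPiI_mul_div (by positivity)]
  unfold ramanujanTwoPow
  by_cases h : (2 : ℤ) ^ b ∣ j
  · obtain ⟨q, rfl⟩ := h
    have h2 : ((2 ^ b * q : ℤ) : ℂ) / 2 ^ (b + 1) = q * (1 / 2) := by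
      push_cast
      field_simp
      ring
    rw [h2, if_pos (by simp)]
    have h3 : (2 : ℤ) ^ (b + 1) ∣ 2 ^ b * q ↔ 2 ∣ q := by
      rw [pow_succ, mul_dvd_mul_iff_left (by positivity)]
    simp only [h3, dvd_mul_right, if_true]
    obtain ⟨k, rfl | rfl⟩ := Int.even_or_odd' q
    · rw [if_pos (dvd_mul_right _ _), show ((2 * k : ℤ) : ℂ) * (1 / 2) = k by push_cast; ring]
      simp
    · rw [if_neg (by omega), show ((2 * k + 1 : ℤ) : ℂ) * (1 / 2) = k + 1 / 2 by push_cast; ring,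
        expTwoPiI_add, expTwoPiI_half]
      simp
  · have h3 : ¬ (2 : ℤ) ^ (b + 1) ∣ j := fun h' => h ((pow_dvd_pow _ (Nat.le_succ b)).trans h')
    rw [if_neg (by simpa using h), if_neg h3, if_neg h]
    simp

/-- The Gauss sum of the character modulo 4; the factor `i` makes it an integer. -/
theorem expTwoPiI_quarter_sub (q : ℤ) :
    Complex.I * (expTwoPiI (q / 4) - expTwoPiI (3 * q / 4)) =
      ((-2 * ZMod.χ₄ (q : ZMod 4) : ℤ) : ℂ) := by
  have h3 : expTwoPiI (3 * q / 4) = expTwoPiI (q / 4) ^ 3 := by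
    rw [expTwoPiI_pow]
    congr 1
    push_cast
    ring
  obtain ⟨k, r, hr, rfl⟩ : ∃ (k : ℤ) (r : ℕ), r < 4 ∧ q = 4 * k + r :=
    ⟨q / 4, (q % 4).toNat, by omega, by omega⟩
  have h4 : expTwoPiI (((4 * k + r : ℤ) : ℂ) / 4) = Complex.I ^ r := by
    rw [show ((4 * k + r : ℤ) : ℂ) / 4 = k + r * (1 / 4) by push_cast; ring, expTwoPiI_add,
      ← expTwoPiI_pow, expTwoPiI_quarter]
    simp
  have h5 : ((4 * k + r : ℤ) : ZMod 4) = (r : ZMod 4) := by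
    have : (4 : ZMod 4) = 0 := rfl
    push_cast
    rw [this]
    ring
  rw [h3, h4, h5]
  interval_cases r
  · simp
  · rw [show ZMod.χ₄ ((1 : ℕ) : ZMod 4) = 1 from rfl]
    push_cast
    -- Here and below the coefficient is the polynomial quotient by `I ^ 2 + 1`.
    linear_combination (2 - Complex.I ^ 2) * Complex.I_mul_I
  · rw [show ZMod.χ₄ ((2 : ℕ) : ZMod 4) = 0 from rfl]
    push_cast
    linear_combination Complex.I * (1 - Complex.I ^ 2) * (Complex.I * Complex.I) * Complex.I_mul_I
  · rw [show ZMod.χ₄ ((3 : ℕ) : ZMod 4) = -1 from rfl]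
    push_cast
    linear_combination (-Complex.I ^ 8 + Complex.I ^ 6 - Complex.I ^ 4 + 2 * Complex.I ^ 2 - 2) *
      Complex.I_mul_I

/-- Pair `4s + 1` with `4s + 3`, where the character is `1` and `-1`: the sum over `s` is geometric,
and its cofactor is the Gauss sum of order 4. -/
theorem sum_χ₄_mul_expTwoPiI_odd (b : ℕ) (j : ℤ) :
    ∑ t ∈ Finset.range (2 ^ (b + 1)), Complex.I * (ZMod.χ₄ ((2 * t + 1 : ℕ) : ZMod 4) : ℂ) *
      expTwoPiI (j * (2 * t + 1 : ℕ) / (2 : ℂ) ^ (b + 2)) = twistedRamanujanTwoPow (b + 1) j := by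
  have h0 : (4 : ZMod 4) = 0 := rfl
  have h1 : ∀ s : ℕ, Complex.I * (ZMod.χ₄ ((2 * (2 * s) + 1 : ℕ) : ZMod 4) : ℂ) *
      expTwoPiI (j * (2 * (2 * s) + 1 : ℕ) / (2 : ℂ) ^ (b + 2)) +
      Complex.I * (ZMod.χ₄ ((2 * (2 * s + 1) + 1 : ℕ) : ZMod 4) : ℂ) *
      expTwoPiI (j * (2 * (2 * s + 1) + 1 : ℕ) / (2 : ℂ) ^ (b + 2)) =
      Complex.I * (expTwoPiI (j / 2 ^ (b + 2)) - expTwoPiI (3 * j / 2 ^ (b + 2))) *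
        expTwoPiI (j * s / (2 ^ b : ℕ)) := by
    intro s
    have h2 : ((2 * (2 * s) + 1 : ℕ) : ZMod 4) = 1 := by
      push_cast
      linear_combination (s : ZMod 4) * h0
    have h3 : ((2 * (2 * s + 1) + 1 : ℕ) : ZMod 4) = 3 := by
      push_cast
      linear_combination (s : ZMod 4) * h0
    rw [h2, h3, show ZMod.χ₄ 1 = 1 from rfl, show ZMod.χ₄ 3 = -1 from rfl, mul_assoc _ (_ - _),
      sub_mul, ← expTwoPiI_add, ← expTwoPiI_add]
    have h4 : (j : ℂ) / 2 ^ (b + 2) + j * s / (2 ^ b : ℕ) =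
        j * (2 * (2 * s) + 1 : ℕ) / (2 : ℂ) ^ (b + 2) := by
      push_cast
      field_simp
      ring
    have h5 : 3 * (j : ℂ) / 2 ^ (b + 2) + j * s / (2 ^ b : ℕ) =
        j * (2 * (2 * s + 1) + 1 : ℕ) / (2 : ℂ) ^ (b + 2) := by
      push_cast
      field_simp
      ring
    rw [h4, h5]
    push_cast
    ring
  rw [pow_succ', Finset.sum_range_two_mul]
  simp only [h1]
  rw [← Finset.mul_sum, sum_expTwoPiI_mul_div (by positivity), twistedRamanujanTwoPow,
    Nat.add_sub_cancel]
  by_cases h : (2 : ℤ) ^ b ∣ j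
  · rw [if_pos h, if_pos (by simpa using h)]
    obtain ⟨q, rfl⟩ := h
    have h2 : ((2 ^ b * q : ℤ) : ℂ) / 2 ^ (b + 2) = q / 4 := by
      push_cast
      field_simp
      ring
    have h3 : 3 * ((2 ^ b * q : ℤ) : ℂ) / 2 ^ (b + 2) = 3 * q / 4 := by
      rw [mul_div_assoc, h2]
      ring
    rw [h2, h3, expTwoPiI_quarter_sub, Int.mul_ediv_cancel_left _ (by positivity)]
    push_cast
    ring
  · rw [if_neg h, if_neg (by simpa using h)]
    simp

/-- Makes layers 4 and above invisible modulo 8, the finest modulus that will be needed. -/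
theorem eight_dvd_ramanujanTwoPow {b : ℕ} (hb : 3 ≤ b) (j : ℤ) : 8 ∣ ramanujanTwoPow b j := by
  have h : (8 : ℤ) ∣ 2 ^ b := pow_dvd_pow (2 : ℤ) hb
  unfold ramanujanTwoPow
  split_ifs
  · exact h
  · exact (dvd_neg).2 h
  · exact dvd_zero _

theorem eight_dvd_twistedRamanujanTwoPow {b : ℕ} (hb : 3 ≤ b) (j : ℤ) :
    8 ∣ twistedRamanujanTwoPow b j := by
  have h : (8 : ℤ) ∣ 2 ^ b := pow_dvd_pow (2 : ℤ) hb
  unfold twistedRamanujanTwoPow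
  split_ifs
  · exact ((dvd_neg).2 h).mul_right _
  · exact dvd_zero _

theorem ramanujanTwoPow_eq_zero {b : ℕ} (hb : 2 ≤ b) {j : ℤ} (hj : ¬ 4 ∣ j) :
    ramanujanTwoPow b j = 0 := by
  have h : ∀ k, 2 ≤ k → ¬ (2 : ℤ) ^ k ∣ j := fun k hk h => hj ((pow_dvd_pow (2 : ℤ) hk).trans h)
  rw [ramanujanTwoPow, if_neg (h _ (by omega)), if_neg (h _ hb)]

theorem twistedRamanujanTwoPow_eq_zero {b : ℕ} (hb : 3 ≤ b) {j : ℤ} (hj : ¬ 4 ∣ j) :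
    twistedRamanujanTwoPow b j = 0 := by
  have h : ∀ k, 2 ≤ k → ¬ (2 : ℤ) ^ k ∣ j := fun k hk h => hj ((pow_dvd_pow (2 : ℤ) hk).trans h)
  rw [twistedRamanujanTwoPow, if_neg (h _ (by omega))]

/-! ### Entries of the Hermitian adjacency matrix. -/

/-- The sign function `σ`, extended by `0` outside `D`. -/
def extendedSign (D : Finset ℕ) (σ : {d // d ∈ D} → ℤˣ) (d : ℕ) : ℤ :=
  if h : d ∈ D then (σ ⟨d, h⟩ : ℤ) else 0

theorem extendedSign_eq_zero_iff {D : Finset ℕ} {σ : {d // d ∈ D} → ℤˣ} {d : ℕ} :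
    extendedSign D σ d = 0 ↔ d ∉ D := by
  unfold extendedSign
  split_ifs with h <;> simp [h]

/-- The entry `h_{u, u + c}` of the Hermitian adjacency matrix of `imcg n B D σ`. -/
noncomputable def imcgCoeff (n : ℕ) (B D : Finset ℕ) (σ : {d // d ∈ D} → ℤˣ) (c : ZMod n) : ℂ :=
  (if Nat.gcd c.val n ∈ B then 1 else 0) + Complex.I * ((extendedSign D σ (Nat.gcd c.val n) *
    ZMod.χ₄ ((c.val / Nat.gcd c.val n : ℕ) : ZMod 4) : ℤ) : ℂ)

theorem ZMod.χ₄_neg (a : ZMod 4) : ZMod.χ₄ (-a) = -ZMod.χ₄ a := by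
  revert a; decide

theorem ZMod.χ₄_natCast_eq_unit_iff (m : ℕ) (u : ℤˣ) :
    ZMod.χ₄ (m : ZMod 4) = u ↔ (m : ℤ) ≡ u [ZMOD 4] := by
  have h : ∀ (a : ZMod 4) (u : ℤˣ), ZMod.χ₄ a = u ↔ a = ((u : ℤ) : ZMod 4) := by decide
  rw [h]
  have := ZMod.intCast_eq_intCast_iff (m : ℤ) (u : ℤ) 4
  rw [Int.cast_natCast] at this
  exact this

theorem ZMod.χ₄_natCast_odd {m : ℕ} (hm : Odd m) :
    ZMod.χ₄ (m : ZMod 4) = 1 ∨ ZMod.χ₄ (m : ZMod 4) = -1 := by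
  obtain h | h := (Nat.odd_mod_four_iff.1 (Nat.odd_iff.1 hm) : m % 4 = 1 ∨ m % 4 = 3)
  · exact Or.inl (ZMod.χ₄_nat_one_mod_four h)
  · exact Or.inr (ZMod.χ₄_nat_three_mod_four h)

theorem one_le_val_of_gcd_lt {n : ℕ} {c : ZMod n} (h : Nat.gcd c.val n < n) : 1 ≤ c.val := by
  by_contra hc
  have : c.val = 0 := by omega
  rw [this, Nat.gcd_zero_left] at h
  exact lt_irrefl _ h

section

variable {n : ℕ} [NeZero n] {B D : Finset ℕ} {σ : {d // d ∈ D} → ℤˣ}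

theorem four_mul_dvd_of_mem (hD : ∀ d ∈ D, 4 ∣ n ∧ d ∣ n / 4) {d : ℕ} (hd : d ∈ D) :
    4 * d ∣ n := by
  obtain ⟨⟨k, rfl⟩, h⟩ := hD d hd
  rw [Nat.mul_div_cancel_left _ (by norm_num)] at h
  exact mul_dvd_mul_left 4 h

theorem lt_of_mem_of_four_mul_dvd (hD : ∀ d ∈ D, 4 ∣ n ∧ d ∣ n / 4) {d : ℕ} (hd : d ∈ D) :
    d < n := by
  have h1 := Nat.le_of_dvd (NeZero.pos n) (four_mul_dvd_of_mem hD hd)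
  have h2 := NeZero.pos n
  omega

theorem mem_imcgSet_iff (hB : ∀ d ∈ B, d ∣ n ∧ d < n) (hD : ∀ d ∈ D, 4 ∣ n ∧ d ∣ n / 4)
    (c : ZMod n) : c ∈ imcgSet n B D σ ↔ Nat.gcd c.val n ∈ B ∨
      ∃ h : Nat.gcd c.val n ∈ D,
        ZMod.χ₄ ((c.val / Nat.gcd c.val n : ℕ) : ZMod 4) = σ ⟨_, h⟩ := by
  simp only [imcgSet, Set.mem_union, Set.mem_iUnion, gcdClass, gcdClassMod, Set.mem_ofPred_eq]
  refine or_congr ?_ ?_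
  · constructor
    · rintro ⟨d, hd, -, rfl⟩
      exact hd
    · intro h
      exact ⟨_, h, one_le_val_of_gcd_lt (hB _ h).2, rfl⟩
  · constructor
    · rintro ⟨⟨d, hd⟩, ⟨h1, rfl⟩, k, hk, hkσ⟩
      refine ⟨hd, (ZMod.χ₄_natCast_eq_unit_iff _ _).2 ?_⟩
      have : c.val / Nat.gcd c.val n = k :=
        Nat.div_eq_of_eq_mul_right (Nat.gcd_pos_of_pos_left _ h1) hk
      rwa [this]
    · rintro ⟨h, hχ⟩
      exact ⟨⟨_, h⟩, ⟨one_le_val_of_gcd_lt (lt_of_mem_of_four_mul_dvd hD h), rfl⟩, _,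
        (Nat.mul_div_cancel' (Nat.gcd_dvd_left _ _)).symm, (ZMod.χ₄_natCast_eq_unit_iff _ _).1 hχ⟩

theorem gcd_val_neg (c : ZMod n) : Nat.gcd (-c).val n = Nat.gcd c.val n := by
  rw [ZMod.neg_val]
  split_ifs with h
  · simp [h]
  · exact Nat.gcd_self_sub_left c.val_lt.le

/-- With `d` the gcd, `(n - c)/d = n/d - c/d` and `4 ∣ n/d`. Hence exactly one of `c`, `-c` is
selected, and `D` produces arcs only. -/
theorem χ₄_val_neg_div (hD : ∀ d ∈ D, 4 ∣ n ∧ d ∣ n / 4) {c : ZMod n}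
    (h : Nat.gcd c.val n ∈ D) :
    ZMod.χ₄ (((-c).val / Nat.gcd c.val n : ℕ) : ZMod 4) =
      -ZMod.χ₄ ((c.val / Nat.gcd c.val n : ℕ) : ZMod 4) := by
  have hlt := one_le_val_of_gcd_lt (lt_of_mem_of_four_mul_dvd hD h)
  obtain ⟨k, hk⟩ := four_mul_dvd_of_mem hD h
  obtain ⟨q, hq⟩ := Nat.gcd_dvd_left c.val n
  have hg : 0 < Nat.gcd c.val n := Nat.gcd_pos_of_pos_left _ hlt
  have hc : c ≠ 0 := by
    rintro rfl
    simp at hlt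
  have hle := c.val_lt.le
  rw [ZMod.neg_val, if_neg hc]
  generalize Nat.gcd c.val n = g at *
  rw [hq] at hle ⊢
  have h1 : q ≤ 4 * k := by
    refine le_of_mul_le_mul_left ?_ hg
    calc g * q ≤ n := hle
      _ = g * (4 * k) := by rw [hk]; ring
  have h2 : n - g * q = g * (4 * k - q) := by
    rw [Nat.mul_sub]
    congr 1
    rw [hk]; ring
  rw [h2, Nat.mul_div_cancel_left _ hg, Nat.mul_div_cancel_left _ hg, ← ZMod.χ₄_neg]
  congr 1
  have h4 : (4 : ZMod 4) = 0 := rfl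
  push_cast [h1]
  rw [h4]
  ring

theorem odd_val_div_gcd (hD : ∀ d ∈ D, 4 ∣ n ∧ d ∣ n / 4) {c : ZMod n}
    (h : Nat.gcd c.val n ∈ D) : Odd (c.val / Nat.gcd c.val n) := by
  have hg : 0 < Nat.gcd c.val n := Nat.gcd_pos_of_pos_right _ (NeZero.pos n)
  have h1 := Nat.coprime_div_gcd_div_gcd hg
  have h2 : 2 ∣ n / Nat.gcd c.val n := by
    obtain ⟨k, hk⟩ := four_mul_dvd_of_mem hD h
    exact ⟨2 * k, Nat.div_eq_of_eq_mul_right hg (hk.trans (by ring))⟩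
  exact Nat.Coprime.odd_of_right (h1.coprime_dvd_right h2)

theorem hermitianAdj_imcg (hB : ∀ d ∈ B, d ∣ n ∧ d < n) (hD : ∀ d ∈ D, 4 ∣ n ∧ d ∣ n / 4)
    (hBD : Disjoint B D) (u v : ZMod n) :
    (imcg n B D σ).hermitianAdj u v = imcgCoeff n B D σ (v - u) := by
  have he : (imcg n B D σ).edge u v ↔ v - u ∈ imcgSet n B D σ ∧
      ¬ (v - u ∈ imcgSet n B D σ ∧ -(v - u) ∉ imcgSet n B D σ) := Iff.rfl
  have ha : (imcg n B D σ).arc u v ↔ v - u ∈ imcgSet n B D σ ∧ -(v - u) ∉ imcgSet n B D σ :=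
    Iff.rfl
  have ha' : (imcg n B D σ).arc v u ↔ -(v - u) ∈ imcgSet n B D σ ∧ v - u ∉ imcgSet n B D σ := by
    have : (imcg n B D σ).arc v u ↔ u - v ∈ imcgSet n B D σ ∧ -(u - v) ∉ imcgSet n B D σ :=
      Iff.rfl
    rwa [neg_sub, ← neg_sub v u] at this
  simp only [MixedGraph.hermitianAdj, Matrix.of_apply]
  rw [he, ha, ha']
  clear he ha ha'
  generalize v - u = c
  have hc := mem_imcgSet_iff (σ := σ) hB hD c
  have hc' := mem_imcgSet_iff (σ := σ) hB hD (-c)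
  simp only [gcd_val_neg] at hc'
  simp only [imcgCoeff]
  by_cases h1 : Nat.gcd c.val n ∈ B
  · have h2 : Nat.gcd c.val n ∉ D := fun h => Finset.disjoint_left.1 hBD h1 h
    rw [extendedSign_eq_zero_iff.2 h2]
    simp [hc, hc', h1]
  · by_cases h2 : Nat.gcd c.val n ∈ D
    · have h3 := χ₄_val_neg_div hD h2
      have h4 := ZMod.χ₄_natCast_odd (odd_val_div_gcd hD h2)
      simp only [h3] at hc'
      simp only [hc, hc', h1, extendedSign, h2, exists_true_left, dite_true, false_or]
      obtain h5 | h5 := h4 <;> obtain h6 | h6 := Int.units_eq_one_or (σ ⟨_, h2⟩) <;>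
        simp [h5, h6]
    · rw [extendedSign_eq_zero_iff.2 h2]
      simp [hc, hc', h1, h2]

/-- Any representative may be used: reduction modulo `n` changes the quotient by a multiple of
`n/d`, which is divisible by 4 when `d ∈ D`. -/
theorem imcgCoeff_natCast (hD : ∀ d ∈ D, 4 ∣ n ∧ d ∣ n / 4) (N : ℕ) :
    imcgCoeff n B D σ (N : ZMod n) = (if Nat.gcd N n ∈ B then 1 else 0) +
      Complex.I * ((extendedSign D σ (Nat.gcd N n) *
        ZMod.χ₄ ((N / Nat.gcd N n : ℕ) : ZMod 4) : ℤ) : ℂ) := by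
  have hgcd : Nat.gcd (N % n) n = Nat.gcd N n := by
    rw [Nat.gcd_comm N, Nat.gcd_rec n N]
  rw [imcgCoeff, ZMod.val_natCast, hgcd]
  by_cases h : Nat.gcd N n ∈ D
  · congr 4
    obtain ⟨k, hk⟩ := four_mul_dvd_of_mem hD h
    have hg : 0 < Nat.gcd N n := Nat.gcd_pos_of_pos_right _ (NeZero.pos n)
    obtain ⟨q, hq⟩ := Nat.gcd_dvd_left N n
    generalize Nat.gcd N n = g at *
    have h1 : N % n / g = q % (4 * k) := by
      rw [hk, hq, show 4 * g * k = g * (4 * k) by ring, Nat.mul_mod_mul_left,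
        Nat.mul_div_cancel_left _ hg]
    have h2 : N / g = q % (4 * k) + 4 * (k * (q / (4 * k))) := by
      rw [hq, Nat.mul_div_cancel_left _ hg, ← mul_assoc, Nat.mod_add_div]
    have h4 : (4 : ZMod 4) = 0 := rfl
    rw [h1, h2, Nat.cast_add, Nat.cast_mul 4, Nat.cast_ofNat, h4, zero_mul, add_zero]
  · rw [extendedSign_eq_zero_iff.2 h, zero_mul, zero_mul]

end

/-! ### Splitting the spectrum along `n = 2^e m`. -/

theorem ZMod.sum_eq_sum_range_mul {M : Type*} [AddCommMonoid M] {p q : ℕ} [NeZero (p * q)]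
    (hpq : Nat.Coprime p q) (G : ZMod (p * q) → M) :
    ∑ c, G c = ∑ y ∈ Finset.range p, ∑ x ∈ Finset.range q, G ((y * q + p * x : ℕ)) := by
  have hp : p ≠ 0 := left_ne_zero_of_mul (NeZero.ne (p * q))
  have hq : q ≠ 0 := right_ne_zero_of_mul (NeZero.ne (p * q))
  have hinj : Set.InjOn (fun z : ℕ × ℕ => ((z.1 * q + p * z.2 : ℕ) : ZMod (p * q)))
      (Finset.range p ×ˢ Finset.range q : Finset (ℕ × ℕ)) := by
    rintro ⟨y, x⟩ hyx ⟨y', x'⟩ hyx' h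
    simp only [Finset.coe_product, Finset.coe_range, Set.mem_prod, Set.mem_Iio] at hyx hyx'
    have h1 : y * q + p * x ≡ y' * q + p * x' [MOD p * q] :=
      (ZMod.natCast_eq_natCast_iff _ _ _).1 h
    have hy : y * q ≡ y' * q [MOD p] := by
      have := h1.of_mul_right q
      simpa [Nat.ModEq, Nat.add_mul_mod_self_left] using this
    have hx : p * x ≡ p * x' [MOD q] := by
      have := h1.of_mul_left p
      simpa [Nat.ModEq, Nat.mul_add_mod_self_right] using this
    have hy' := Nat.ModEq.cancel_right_of_coprime hpq hy
    have hx' := Nat.ModEq.cancel_left_of_coprime hpq.symm hx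
    exact Prod.ext (hy'.eq_of_lt_of_lt hyx.1 hyx'.1) (hx'.eq_of_lt_of_lt hyx.2 hyx'.2)
  rw [← Finset.sum_product']
  symm
  refine Finset.sum_nbij _ (fun _ _ => Finset.mem_univ _) hinj ?_ fun _ _ => rfl
  refine Finset.surjOn_of_injOn_of_card_le _ (fun _ _ => Finset.mem_coe.2 (Finset.mem_univ _))
    hinj ?_
  simp [ZMod.card]

/-- For `n = 2 ^ e * m`, whether `2 ^ (e - a) * g` belongs to `B`. -/
def evenCoeff (e : ℕ) (B : Finset ℕ) (a g : ℕ) : ℤ :=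
  if a ≤ e ∧ 2 ^ (e - a) * g ∈ B then 1 else 0

/-- For `n = 2 ^ e * m`, the sign of `2 ^ (e - a) * g` twisted by the character modulo `4`. -/
def oddCoeff (e m : ℕ) (D : Finset ℕ) (σ : {d // d ∈ D} → ℤˣ) (a g : ℕ) : ℤ :=
  if a ≤ e then extendedSign D σ (2 ^ (e - a) * g) * ZMod.χ₄ ((m / g : ℕ) : ZMod 4) else 0

theorem Nat.gcd_mul_add_mul {p q : ℕ} (h : Nat.Coprime p q) (y x : ℕ) :
    Nat.gcd (y * q + p * x) (p * q) = Nat.gcd y p * Nat.gcd x q := by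
  rw [h.gcd_mul, Nat.gcd_add_mul_left_left, h.symm.gcd_mul_right_cancel, Nat.gcd_mul_right_add_left,
    h.gcd_mul_left_cancel]

theorem stdAddChar_natCast_mul_intCast {n : ℕ} [NeZero n] (N : ℕ) (j : ℤ) :
    ZMod.stdAddChar ((N : ZMod n) * (j : ZMod n)) = expTwoPiI (j * N / n) := by
  have h : (N : ZMod n) * (j : ZMod n) = ((N * j : ℤ) : ZMod n) := by
    rw [Int.cast_mul, Int.cast_natCast]
  rw [h, ZMod.stdAddChar_coe, expTwoPiI]
  congr 1
  push_cast
  ring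

section

variable {e m : ℕ} [NeZero (2 ^ e * m)] {B D : Finset ℕ} {σ : {d // d ∈ D} → ℤˣ}

theorem two_le_of_mem (hm : Odd m) (hD : ∀ d ∈ D, 4 ∣ 2 ^ e * m ∧ d ∣ 2 ^ e * m / 4) {a g : ℕ}
    (ha : a ≤ e) (h : 2 ^ (e - a) * g ∈ D) : 2 ≤ a := by
  have h1 : 2 ^ (e - a + 2) ∣ 2 ^ e * m :=
    (Dvd.intro g (by ring)).trans (four_mul_dvd_of_mem hD h)
  have h2 := (Nat.Coprime.pow_left _ hm.coprime_two_left).dvd_of_dvd_mul_right h1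
  have h3 := (Nat.pow_dvd_pow_iff_le_right (by norm_num)).1 h2
  omega

theorem oddCoeff_eq_zero (hm : Odd m) (hD : ∀ d ∈ D, 4 ∣ 2 ^ e * m ∧ d ∣ 2 ^ e * m / 4) {a : ℕ}
    (ha : a < 2) (g : ℕ) : oddCoeff e m D σ a g = 0 := by
  unfold oddCoeff
  split_ifs with h
  · rw [extendedSign_eq_zero_iff.2, zero_mul]
    intro h'
    have := two_le_of_mem hm hD h h'
    omega
  · rfl

theorem gcd_two_pow_mul {a y : ℕ} (ha : a ≤ e) (hy : Nat.Coprime y (2 ^ a)) :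
    Nat.gcd (2 ^ (e - a) * y) (2 ^ e) = 2 ^ (e - a) := by
  have : 2 ^ e = 2 ^ (e - a) * 2 ^ a := by rw [← pow_add]; congr 1; omega
  rw [this, Nat.gcd_mul_left, hy.gcd_eq_one, mul_one]

/-- With `g = gcd(x, m)` the quotient by the gcd is `y(m/g) + 2^a(x/g)`. Membership in `D` forces `a
≥ 2`, so the second term vanishes modulo 4 and the character factors. -/
theorem imcgCoeff_two_pow (hm : Odd m) (hD : ∀ d ∈ D, 4 ∣ 2 ^ e * m ∧ d ∣ 2 ^ e * m / 4)
    {a y : ℕ} (ha : a ≤ e) (hy : Nat.Coprime y (2 ^ a)) (x : ℕ) :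
    imcgCoeff (2 ^ e * m) B D σ ((2 ^ (e - a) * y * m + 2 ^ e * x : ℕ) : ZMod (2 ^ e * m)) =
      evenCoeff e B a (Nat.gcd x m) + Complex.I * (ZMod.χ₄ (y : ZMod 4) : ℂ) *
        oddCoeff e m D σ a (Nat.gcd x m) := by
  have hcop : Nat.Coprime (2 ^ e) m := Nat.Coprime.pow_left _ hm.coprime_two_left
  have hm0 : 0 < m := hm.pos
  rw [imcgCoeff_natCast hD, Nat.gcd_mul_add_mul hcop, gcd_two_pow_mul ha hy]
  have hpow : 2 ^ e = 2 ^ (e - a) * 2 ^ a := by rw [← pow_add]; congr 1; omega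
  simp only [evenCoeff, oddCoeff, ha, true_and, if_true]
  rw [mul_assoc Complex.I]
  congr 2
  · split_ifs <;> simp
  · by_cases h : 2 ^ (e - a) * Nat.gcd x m ∈ D
    · have h2 := two_le_of_mem hm hD ha h
      have hg : 0 < Nat.gcd x m := Nat.gcd_pos_of_pos_right _ hm0
      obtain ⟨r, hr⟩ := Nat.gcd_dvd_right x m
      obtain ⟨z, hz⟩ := Nat.gcd_dvd_left x m
      generalize Nat.gcd x m = g at *
      have h3 : (2 ^ (e - a) * y * m + 2 ^ e * x) / (2 ^ (e - a) * g) = y * r + 2 ^ a * z := by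
        refine Nat.div_eq_of_eq_mul_right (by positivity) ?_
        rw [hpow, hr, hz]
        ring
      have h4 : (((y * r + 2 ^ a * z : ℕ)) : ZMod 4) = (y : ZMod 4) * (r : ZMod 4) := by
        obtain ⟨k, rfl⟩ := Nat.exists_eq_add_of_le h2
        have : (4 : ZMod 4) = 0 := rfl
        push_cast
        linear_combination (2 ^ k * z : ZMod 4) * this
      have h5 : m / g = r := Nat.div_eq_of_eq_mul_right hg hr
      rw [h3, h4, h5, map_mul]
      push_cast
      ring
    · rw [extendedSign_eq_zero_iff.2 h]
      simp

/-- The integral spectrum of `imcg n B D σ` for `n = 2 ^ e * m` with `m` odd. -/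
theorem sum_imcgCoeff_mul_stdAddChar (hm : Odd m)
    (hD : ∀ d ∈ D, 4 ∣ 2 ^ e * m ∧ d ∣ 2 ^ e * m / 4) {F K : ℕ → ℤ → ℤ}
    (hF : ∀ a, IsFourierTransform m (fun x => evenCoeff e B a (Nat.gcd x m)) (F a))
    (hK : ∀ a, IsFourierTransform m (fun x => oddCoeff e m D σ a (Nat.gcd x m)) (K a)) (j : ℤ) :
    ∑ c, imcgCoeff (2 ^ e * m) B D σ c * ZMod.stdAddChar (c * (j : ZMod (2 ^ e * m))) =
      ((F 0 j + ∑ b ∈ Finset.range e,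
        (ramanujanTwoPow b j * F (b + 1) j + twistedRamanujanTwoPow b j * K (b + 1) j) : ℤ) : ℂ) := by
  have hcop : Nat.Coprime (2 ^ e) m := Nat.Coprime.pow_left _ hm.coprime_two_left
  have hmc : (m : ℂ) ≠ 0 := by exact_mod_cast hm.pos.ne'
  have key : ∀ a ≤ e, ∀ y : ℕ, Nat.Coprime y (2 ^ a) →
      ∑ x ∈ Finset.range m, imcgCoeff (2 ^ e * m) B D σ
          ((2 ^ (e - a) * y * m + 2 ^ e * x : ℕ) : ZMod (2 ^ e * m)) *
        ZMod.stdAddChar (((2 ^ (e - a) * y * m + 2 ^ e * x : ℕ) : ZMod (2 ^ e * m)) *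
          (j : ZMod (2 ^ e * m))) =
      expTwoPiI (j * y / 2 ^ a) * F a j +
        Complex.I * (ZMod.χ₄ (y : ZMod 4) : ℂ) * expTwoPiI (j * y / 2 ^ a) * K a j := by
    intro a ha y hy
    rw [← hF a j, ← hK a j, Finset.mul_sum, Finset.mul_sum, ← Finset.sum_add_distrib]
    refine Finset.sum_congr rfl fun x _ => ?_
    have h1 : (j * (2 ^ (e - a) * y * m + 2 ^ e * x : ℕ) : ℂ) / ((2 ^ e * m : ℕ) : ℂ) =
        j * y / 2 ^ a + j * x / m := by
      have hpow : (2 : ℂ) ^ e = 2 ^ (e - a) * 2 ^ a := by rw [← pow_add]; congr 1; omega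
      push_cast
      rw [hpow]
      field_simp
    rw [imcgCoeff_two_pow hm hD ha hy, stdAddChar_natCast_mul_intCast, h1, expTwoPiI_add]
    ring
  rw [ZMod.sum_eq_sum_range_mul hcop, Finset.sum_range_two_pow]
  have h0 := key 0 (Nat.zero_le _) 0 (by simp)
  have hχ : ZMod.χ₄ ((0 : ℕ) : ZMod 4) = 0 := rfl
  rw [mul_zero (2 ^ (e - 0)), hχ, Nat.cast_zero, mul_zero, zero_div, Int.cast_zero, mul_zero, zero_mul, zero_mul,
    zero_mul, add_zero, expTwoPiI_zero, one_mul] at h0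
  rw [zero_mul m, h0, Int.cast_add, Int.cast_sum]
  congr 1
  refine Finset.sum_congr rfl fun b hb => ?_
  have hb' : b + 1 ≤ e := Finset.mem_range.1 hb
  rw [Finset.sum_congr rfl fun t _ => key (b + 1) hb' (2 * t + 1)
    (Nat.Coprime.pow_right _ (Nat.coprime_two_right.2 ⟨t, rfl⟩)), Finset.sum_add_distrib,
    ← Finset.sum_mul, ← Finset.sum_mul, sum_expTwoPiI_odd, Int.cast_add, Int.cast_mul, Int.cast_mul]
  congr 1
  -- For `b = 0` the twisted sum has no meaning (`b - 1` truncates), but layer 1 contains no `d`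
  -- with `4d ∣ n`, so `K 1` is zero.
  obtain _ | b := b
  · have h1 : K (0 + 1) j = 0 :=
      (hK 1).apply_eq_of_forall_pos hm.pos.ne' (fun x _ _ => oddCoeff_eq_zero hm hD (by norm_num) _) j
        |>.trans (oddCoeff_eq_zero hm hD (by norm_num) _)
    rw [h1]
    simp
  · rw [← sum_χ₄_mul_expTwoPiI_odd]

end

namespace IsFourierTransform

variable {m : ℕ} {g g' : ℕ → ℤ} {W W' : ℤ → ℤ}

theorem apply_eq_of_modEq (hm : m ≠ 0) (h : IsFourierTransform m g W) {w w' : ℤ}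
    (hw : w ≡ w' [ZMOD m]) : W w = W w' := by
  have hmc : (m : ℂ) ≠ 0 := by exact_mod_cast hm
  obtain ⟨q, hq⟩ := Int.modEq_iff_dvd.1 hw
  have h1 : (W w : ℂ) = W w' := by
    rw [← h w, ← h w']
    refine Finset.sum_congr rfl fun x _ => ?_
    have h2 : (w' * x : ℂ) / m = w * x / m + (q * x : ℤ) := by
      have : (w' : ℂ) = w + m * q := by exact_mod_cast (by linear_combination hq : w' = w + m * q)
      rw [this]
      push_cast
      field_simp
    rw [h2, expTwoPiI_add, expTwoPiI_intCast, mul_one]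
  exact_mod_cast h1

theorem apply_sub_apply_eq (hm : m ≠ 0) (h : IsFourierTransform m g W)
    (h' : IsFourierTransform m g' W') (hg : ∀ x, 0 < x → x < m → g x = g' x) (w : ℤ) :
    W w = W' w + (g 0 - g' 0) := by
  have h1 := (h.add (h'.const_mul (-1))).apply_eq_of_forall_pos hm (fun x h0 hx => by
    simp [hg x h0 hx]) w
  simp only [Pi.add_apply] at h1
  linarith

end IsFourierTransform

/-! ### The 2-adic analysis of layered spectra. -/

/-- The data of an integral spectrum `Λ` that splits along powers of `2`. -/
structure IsLayeredSpectrum (m : ℕ) (b k : ℕ → ℕ → ℤ) (F K : ℕ → ℤ → ℤ) (Λ : ℤ → ℤ) : Prop where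
  odd : Odd m
  even_transform : ∀ a, IsFourierTransform m (b a) (F a)
  odd_transform : ∀ a, IsFourierTransform m (k a) (K a)
  even_mem : ∀ a x, b a x = 0 ∨ b a x = 1
  odd_mem : ∀ a x, k a x = 0 ∨ k a x = 1 ∨ k a x = -1
  disjoint : ∀ a x, k a x ≠ 0 → b a x = 0
  -- Layer 0 at `x = 0` stands for the divisor `n`, which `B` excludes.
  even_zero : b 0 0 = 0
  apply_odd : ∀ j : ℤ, Odd j → Λ j = F 0 j - F 1 j - 2 * ZMod.χ₄ (j : ZMod 4) * K 2 j
  apply_two_mul : ∀ q : ℤ, Odd q → Λ (2 * q) =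
    F 0 (2 * q) + F 1 (2 * q) - 2 * F 2 (2 * q) - 4 * ZMod.χ₄ (q : ZMod 4) * K 3 (2 * q)
  apply_four_mul : ∀ q : ℤ, Λ (4 * q) ≡
    F 0 (4 * q) + F 1 (4 * q) + 2 * F 2 (4 * q) + 4 * F 3 (4 * q) [ZMOD 8]

/-- The combinatorial condition for perfect state transfer in terms of layer coefficients. -/
def LayerCondition (m : ℕ) (b k : ℕ → ℕ → ℤ) : Prop :=
  (∀ x, 0 < x → x < m → b 0 x = b 1 x ∧ b 1 x = b 2 x ∧ k 2 x = 0) ∧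
    ((k 2 0 ≠ 0 ∧ b 1 0 = 0) ∨ (k 2 0 = 0 ∧ b 1 0 ≠ b 2 0) ∨
      (k 2 0 = 0 ∧ b 1 0 = 1 ∧ b 2 0 = 1 ∧ k 3 0 ≠ 0 ∧
        ∀ x, 0 < x → x < m → k 3 x = 0 ∧ b 2 x = b 3 x))

/-- Allows the 2-adic class of `j` to be fixed while the argument of the transforms stays arbitrary.
-/
theorem exists_modEq_eight_modEq {m : ℕ} (hm : Odd m) (u w : ℤ) :
    ∃ j : ℤ, j ≡ u [ZMOD 8] ∧ j ≡ w [ZMOD m] := by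
  have hcop : IsCoprime (8 : ℤ) m := by
    have h2 : IsCoprime ((2 : ℤ) ^ 3) m :=
      IsCoprime.pow_left (Nat.isCoprime_iff_coprime.2 hm.coprime_two_left)
    norm_num at h2
    exact h2
  obtain ⟨a, c, h⟩ := hcop
  refine ⟨c * m * u + a * 8 * w, Int.modEq_iff_dvd.2 ⟨a * (u - w), ?_⟩,
    Int.modEq_iff_dvd.2 ⟨c * (w - u), ?_⟩⟩
  · linear_combination -u * h
  · linear_combination -w * h

namespace IsLayeredSpectrum

variable {m : ℕ} {b k : ℕ → ℕ → ℤ} {F K : ℕ → ℤ → ℤ} {Λ : ℤ → ℤ}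

/-- Take `j ≡ w` modulo `m` and `j ≡ 1, 3, 2, 0` modulo 8 in turn. The last formula for `Λ` holds
only modulo 8, whence `u ≤ 3`. -/
theorem dvd_of_phase (S : IsLayeredSpectrum m b k F K Λ) {v : ℕ}
    (h : ∀ j : ℤ, Λ j ≡ Λ 0 + 2 ^ v * j [ZMOD 2 ^ (v + 1)]) (w : ℤ) :
    (2 : ℤ) ^ (v + 1) ∣ F 0 w - F 1 w - 2 * K 2 w - Λ 0 - 2 ^ v ∧
    (2 : ℤ) ^ (v + 1) ∣ F 0 w - F 1 w + 2 * K 2 w - Λ 0 - 2 ^ v ∧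
    (2 : ℤ) ^ (v + 1) ∣ F 0 w + F 1 w - 2 * F 2 w - 4 * K 3 w - Λ 0 ∧
    ∀ u ≤ 3, u ≤ v + 1 → (2 : ℤ) ^ u ∣ F 0 w + F 1 w + 2 * F 2 w + 4 * F 3 w - Λ 0 := by
  have hm0 := S.odd.pos.ne'
  have hF : ∀ {j}, j ≡ w [ZMOD m] → ∀ a, F a j = F a w :=
    fun hj a => (S.even_transform a).apply_eq_of_modEq hm0 hj
  have hK : ∀ {j}, j ≡ w [ZMOD m] → ∀ a, K a j = K a w :=
    fun hj a => (S.odd_transform a).apply_eq_of_modEq hm0 hj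
  have hχ1 : ZMod.χ₄ ((1 : ℤ) : ZMod 4) = 1 := by decide
  have hχ3 : ZMod.χ₄ ((3 : ℤ) : ZMod 4) = -1 := by decide
  have hcast : ∀ {j u : ℤ}, j ≡ u [ZMOD 4] → (j : ZMod 4) = (u : ZMod 4) :=
    fun hj => (ZMod.intCast_eq_intCast_iff _ _ 4).2 hj
  refine ⟨?_, ?_, ?_, ?_⟩
  · obtain ⟨j, h8, hjw⟩ := exists_modEq_eight_modEq S.odd 1 w
    have h4 : j ≡ 1 [ZMOD 4] := h8.of_mul_left 2
    obtain ⟨c, rfl⟩ : Odd j := Int.odd_iff.2 (by have : j % 8 = 1 % 8 := h8; omega)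
    have h1 := S.apply_odd _ ⟨c, rfl⟩
    rw [hcast h4, hχ1, hF hjw, hF hjw, hK hjw] at h1
    obtain ⟨q, hq⟩ := Int.modEq_iff_dvd.1 (h (2 * c + 1)).symm
    refine ⟨q + c, ?_⟩
    rw [h1] at hq
    linear_combination hq
  · obtain ⟨j, h8, hjw⟩ := exists_modEq_eight_modEq S.odd 3 w
    have h4 : j ≡ 3 [ZMOD 4] := h8.of_mul_left 2
    obtain ⟨c, rfl⟩ : Odd j := Int.odd_iff.2 (by have : j % 8 = 3 % 8 := h8; omega)
    have h1 := S.apply_odd _ ⟨c, rfl⟩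
    rw [hcast h4, hχ3, hF hjw, hF hjw, hK hjw] at h1
    obtain ⟨q, hq⟩ := Int.modEq_iff_dvd.1 (h (2 * c + 1)).symm
    refine ⟨q + c, ?_⟩
    rw [h1] at hq
    linear_combination hq
  · obtain ⟨j, h8, hjw⟩ := exists_modEq_eight_modEq S.odd 2 w
    obtain ⟨c, rfl⟩ : ∃ c, j = 2 * c := ⟨j / 2, by have : j % 8 = 2 % 8 := h8; omega⟩
    have h4 : c ≡ 1 [ZMOD 4] := by
      have : (2 : ℤ) * c ≡ 2 * 1 [ZMOD 2 * 4] := h8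
      exact Int.ModEq.mul_left_cancel' (by norm_num) this
    have h1 := S.apply_two_mul c
      (Int.odd_iff.2 (by have : c % 4 = 1 % 4 := h4; omega))
    rw [hcast h4, hχ1, hF hjw, hF hjw, hF hjw, hK hjw] at h1
    obtain ⟨q, hq⟩ := Int.modEq_iff_dvd.1 (h (2 * c)).symm
    refine ⟨q + c, ?_⟩
    rw [h1] at hq
    linear_combination hq
  · intro u hu3 hu
    obtain ⟨j, h8, hjw⟩ := exists_modEq_eight_modEq S.odd 0 w
    obtain ⟨c, rfl⟩ : (4 : ℤ) ∣ j := Int.modEq_zero_iff_dvd.1 (h8.of_mul_left 2)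
    have h1 := S.apply_four_mul c
    rw [hF hjw, hF hjw, hF hjw, hF hjw] at h1
    have h2 : (2 : ℤ) ^ u ∣ 8 := pow_dvd_pow (2 : ℤ) hu3
    have h3 : (2 : ℤ) ^ u ∣ 2 ^ (v + 1) := pow_dvd_pow (2 : ℤ) hu
    have h4 : (2 : ℤ) ^ (v + 1) ∣ Λ (4 * c) - Λ 0 := by
      obtain ⟨q, hq⟩ := Int.modEq_iff_dvd.1 (h (4 * c)).symm
      exact ⟨q + 2 * c, by linear_combination hq⟩
    have := dvd_add (h2.trans (Int.modEq_iff_dvd.1 h1)) (h3.trans h4)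
    rwa [sub_add_sub_cancel] at this

theorem layerCondition_of_phase (S : IsLayeredSpectrum m b k F K Λ) {v : ℕ}
    (h : ∀ j : ℤ, Λ j ≡ Λ 0 + 2 ^ v * j [ZMOD 2 ^ (v + 1)]) : LayerCondition m b k := by
  have hm0 := S.odd.pos.ne'
  have hcop : ∀ u : ℕ, IsCoprime ((2 : ℤ) ^ u) m := fun u =>
    IsCoprime.pow_left (Nat.isCoprime_iff_coprime.2 S.odd.coprime_two_left)
  choose hA hA' hE hE' using S.dvd_of_phase h
  -- Modulo 2, odd and even `j` both yield `F 0 + F 1 - Λ 0`, so they cannot differ by `2^0`.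
  have hv : v ≠ 0 := by
    rintro rfl
    have h1 := hA 0
    have h2 := hE 0
    norm_num at h1 h2
    omega
  obtain ⟨u, rfl⟩ := Nat.exists_eq_succ_of_ne_zero hv
  rw [Nat.succ_eq_add_one] at *
  -- `b 0 + b 1 + 2 b 2` has transform constant modulo 4, and for 0/1 values divisibility by 4
  -- forces all three to agree.
  have hb : ∀ x, 0 < x → x < m → b 0 x = b 1 x ∧ b 1 x = b 2 x := by
    intro x hx0 hx
    have h1 : (2 : ℤ) ^ 2 ∣ _ := (((S.even_transform 0).add (S.even_transform 1)).add
      ((S.even_transform 2).const_mul 2)).dvd_of_modEq hm0 (by norm_num) (hcop 2) (c := Λ 0)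
      (fun w => by
        have := hE' w 2 (by norm_num) (by omega)
        simp only [Pi.add_apply, Int.modEq_iff_dvd]
        norm_num at this ⊢
        omega) hx0 hx
    simp only [Pi.add_apply] at h1
    norm_num at h1
    have := S.even_mem 0 x
    have := S.even_mem 1 x
    have := S.even_mem 2 x
    omega
  -- Subtracting `hA` from `hE` and halving gives `F 1 - F 2 + K 2` constant modulo 2; as `b 1 = b
  -- 2` here, `k 2 x` is even.
  have hk : ∀ x, 0 < x → x < m → k 2 x = 0 := by
    intro x hx0 hx
    have h1 : (2 : ℤ) ^ 1 ∣ _ := (((S.even_transform 1).add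
      ((S.even_transform 2).const_mul (-1))).add (S.odd_transform 2)).dvd_of_modEq hm0
      (by norm_num) (hcop 1) (c := 2 ^ u)
      (fun w => by
        have h3 := dvd_sub (hE w) (hA w)
        rw [pow_succ _ (u + 1), pow_succ] at h3
        have h4 : (4 : ℤ) ∣ 2 ^ u * 2 * 2 := ⟨2 ^ u, by ring⟩
        have h5 := h4.trans h3
        simp only [Pi.add_apply, Int.modEq_iff_dvd]
        generalize (2 : ℤ) ^ u = M at *
        omega) hx0 hx
    simp only [Pi.add_apply] at h1
    have := hb x hx0 hx
    have := S.odd_mem 2 x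
    omega
  have hF1 : ∀ w, F 1 w = F 0 w + b 1 0 := fun w => by
    rw [(S.even_transform 1).apply_sub_apply_eq hm0 (S.even_transform 0)
      (fun x h0 hx => (hb x h0 hx).1.symm) w, S.even_zero, sub_zero]
  have hF2 : ∀ w, F 2 w = F 0 w + b 2 0 := fun w => by
    rw [(S.even_transform 2).apply_sub_apply_eq hm0 (S.even_transform 0)
      (fun x h0 hx => ((hb x h0 hx).1.trans (hb x h0 hx).2).symm) w, S.even_zero, sub_zero]
  have hK2 : ∀ w, K 2 w = k 2 0 := (S.odd_transform 2).apply_eq_of_forall_pos hm0 hk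
  refine ⟨fun x h0 hx => ⟨(hb x h0 hx).1, (hb x h0 hx).2, hk x h0 hx⟩, ?_⟩
  simp only [hF1, hF2, hK2] at hA hA' hE hE'
  have hβ1 := S.even_mem 1 0
  have hβ2 := S.even_mem 2 0
  by_cases hκ : k 2 0 = 0
  · refine Or.inr ?_
    by_cases hne : b 1 0 = b 2 0
    swap
    · exact Or.inl ⟨hκ, hne⟩
    refine Or.inr ⟨hκ, ?_⟩
    rw [← hne] at hE hE' ⊢
    rw [hκ] at hA
    have h3 : ∀ w, (2 : ℤ) ^ (u + 1 + 1) ∣ 2 ^ (u + 1) - 4 * K 3 w := fun w => by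
      have := dvd_sub (hE w) (hA w)
      convert! this using 1
      ring
    -- `v = 1` would require `4 ∣ 2 - 4 * K 3 w`; from here on `v = u + 2`.
    obtain _ | u := u
    · have := h3 0
      norm_num at this
      omega
    have h4 : ∀ w, (2 : ℤ) ^ (u + 1) ∣ 2 ^ u - K 3 w := fun w => by
      obtain ⟨q, hq⟩ := h3 w
      refine ⟨q, mul_left_cancel₀ (a := (4 : ℤ)) (by norm_num) ?_⟩
      rw [pow_succ, pow_succ, pow_succ, pow_succ] at hq
      rw [pow_succ]
      linear_combination hq
    have hk3 : ∀ x, 0 < x → x < m → k 3 x = 0 := by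
      intro x hx0 hx
      have h5 := (S.odd_transform 3).dvd_of_modEq hm0 (by positivity) (hcop (u + 1))
        (c := 2 ^ u) (fun w => Int.modEq_iff_dvd.2 (h4 w)) hx0 hx
      have h6 := (dvd_pow_self (2 : ℤ) (Nat.succ_ne_zero u)).trans h5
      have := S.odd_mem 3 x
      omega
    have hK3 : ∀ w, K 3 w = k 3 0 := (S.odd_transform 3).apply_eq_of_forall_pos hm0 hk3
    have h5 := h4 0
    rw [hK3] at h5
    have hκ3 : k 3 0 ≠ 0 := by
      intro h6
      rw [h6, sub_zero, pow_dvd_pow_iff (by norm_num) (by decide)] at h5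
      omega
    -- `k 3 0` is `±1` and congruent to `2^u` modulo `2^(u+1)`, so `2^u` is odd.
    have hu : u = 0 := by
      by_contra hu
      have h6 : (2 : ℤ) ∣ 2 ^ u := dvd_pow_self 2 hu
      have h7 := (dvd_pow_self (2 : ℤ) (Nat.succ_ne_zero u)).trans h5
      have := S.odd_mem 3 0
      omega
    subst hu
    have hβ3 := S.disjoint 3 0 hκ3
    have h6 : ∀ w, (2 : ℤ) ∣ F 0 w + F 3 w + b 1 0 + 1 := fun w => by
      have h7 := hA w
      have h8 := hE' w 3 le_rfl (by norm_num)
      norm_num at h7 h8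
      omega
    have hb3 : ∀ x, 0 < x → x < m → b 0 x = b 3 x := by
      intro x hx0 hx
      have h7 : (2 : ℤ) ^ 1 ∣ _ := ((S.even_transform 0).add (S.even_transform 3)).dvd_of_modEq hm0
        (by norm_num) (hcop 1) (c := b 1 0 + 1) (fun w => by
          have := h6 w
          simp only [Pi.add_apply, Int.modEq_iff_dvd]
          omega) hx0 hx
      simp only [Pi.add_apply] at h7
      have := S.even_mem 0 x
      have := S.even_mem 3 x
      omega
    have h8 := (S.even_transform 3).apply_sub_apply_eq hm0 (S.even_transform 0)
      (fun x h0 hx => (hb3 x h0 hx).symm) 0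
    have h9 := h6 0
    have h10 := S.even_zero
    have h11 : b 1 0 = 1 := by omega
    exact ⟨h11, h11, hκ3, fun x h0 hx => ⟨hk3 x h0 hx,
      ((hb x h0 hx).1.trans (hb x h0 hx).2).symm.trans (hb3 x h0 hx)⟩⟩
  · refine Or.inl ⟨hκ, ?_⟩
    have hκ' := S.odd_mem 2 0
    have h2 := S.disjoint 2 0 hκ
    have h3 := dvd_sub (hA' 0) (hA 0)
    -- The residues 1 and 3 differ by `4 * k 2 0 = ±4`, so the modulus `2^(u+2)` is at most 4.
    have hu : u = 0 := by
      by_contra hu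
      have h4 : (8 : ℤ) ∣ 2 ^ (u + 1 + 1) := pow_dvd_pow (2 : ℤ) (by omega : 3 ≤ u + 1 + 1)
      have h5 := h4.trans h3
      omega
    subst hu
    have h4 := hA 0
    have h5 := hE 0
    norm_num at h4 h5
    omega

/-- All `F a` involved differ from `F 0` by constants, and `F 0` cancels for `j` not divisible by 4.
For `4 ∣ j` it enters as `4 * F 0`, harmless modulo 4; in the last case `F 3 = F 0` raises this to
`8 * F 0`, harmless modulo 8. -/
theorem phase_of_layerCondition (S : IsLayeredSpectrum m b k F K Λ) (h : LayerCondition m b k) :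
    ∃ v : ℕ, ∀ j : ℤ, Λ j ≡ Λ 0 + 2 ^ v * j [ZMOD 2 ^ (v + 1)] := by
  have hm0 := S.odd.pos.ne'
  obtain ⟨hb, hcase⟩ := h
  have hF1 : ∀ w, F 1 w = F 0 w + b 1 0 := fun w => by
    rw [(S.even_transform 1).apply_sub_apply_eq hm0 (S.even_transform 0)
      (fun x h0 hx => (hb x h0 hx).1.symm) w, S.even_zero, sub_zero]
  have hF2 : ∀ w, F 2 w = F 0 w + b 2 0 := fun w => by
    rw [(S.even_transform 2).apply_sub_apply_eq hm0 (S.even_transform 0)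
      (fun x h0 hx => ((hb x h0 hx).1.trans (hb x h0 hx).2.1).symm) w, S.even_zero, sub_zero]
  have hK2 : ∀ w, K 2 w = k 2 0 :=
    (S.odd_transform 2).apply_eq_of_forall_pos hm0 fun x h0 hx => (hb x h0 hx).2.2
  have hodd := S.apply_odd
  have htwo := S.apply_two_mul
  have hfour := S.apply_four_mul
  have hzero := S.apply_four_mul 0
  simp only [hF1, hF2, hK2, mul_zero] at hodd htwo hfour hzero
  have hχ : ∀ j : ℤ, Odd j → ZMod.χ₄ (j : ZMod 4) = 1 ∨ ZMod.χ₄ (j : ZMod 4) = -1 := by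
    intro j hj
    have hj2 := Int.odd_iff.1 hj
    obtain h | h : j % 4 = 1 ∨ j % 4 = 3 := by omega
    · exact Or.inl (ZMod.χ₄_int_one_mod_four h)
    · exact Or.inr (ZMod.χ₄_int_three_mod_four h)
  have hβ1 := S.even_mem 1 0
  have hβ2 := S.even_mem 2 0
  have hκ := S.odd_mem 2 0
  have hcases : ∀ j : ℤ, Odd j ∨ (∃ q, Odd q ∧ j = 2 * q) ∨ ∃ q, j = 4 * q := by
    intro j
    obtain ⟨q, rfl | rfl⟩ := Int.even_or_odd' j
    · obtain ⟨r, rfl | rfl⟩ := Int.even_or_odd' q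
      · exact Or.inr (Or.inr ⟨r, by ring⟩)
      · exact Or.inr (Or.inl ⟨_, ⟨r, rfl⟩, rfl⟩)
    · exact Or.inl ⟨q, rfl⟩
  have hfirst : (k 2 0 ≠ 0 ∧ b 1 0 = 0) ∨ (k 2 0 = 0 ∧ b 1 0 ≠ b 2 0) →
      ∀ j : ℤ, Λ j ≡ Λ 0 + 2 ^ 1 * j [ZMOD 2 ^ (1 + 1)] := by
    intro hc j
    have hd := S.disjoint 2 0
    norm_num
    rw [Int.modEq_iff_dvd] at hzero ⊢
    obtain hj | ⟨q, hq, rfl⟩ | ⟨q, rfl⟩ := hcases j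
    · rw [hodd j hj]
      have hj2 := Int.odd_iff.1 hj
      obtain hc | hc := hχ j hj <;> rw [hc] <;> omega
    · rw [htwo q hq]
      obtain hc | hc := hχ q hq <;> rw [hc] <;> omega
    · have := hfour q
      rw [Int.modEq_iff_dvd] at this
      omega
  obtain hc | hc | ⟨hκ0, h1, h2, hκ3, hb3⟩ := hcase
  · exact ⟨1, hfirst (Or.inl hc)⟩
  · exact ⟨1, hfirst (Or.inr hc)⟩
  · have hK3 : ∀ w, K 3 w = k 3 0 :=
      (S.odd_transform 3).apply_eq_of_forall_pos hm0 fun x h0 hx => (hb3 x h0 hx).1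
    have hF3 : ∀ w, F 3 w = F 0 w := fun w => by
      rw [(S.even_transform 3).apply_sub_apply_eq hm0 (S.even_transform 2)
        (fun x h0 hx => (hb3 x h0 hx).2.symm) w, hF2, S.disjoint 3 0 hκ3]
      ring
    have hκ3' := S.odd_mem 3 0
    simp only [hK3, hF3] at htwo hfour hzero
    refine ⟨2, fun j => ?_⟩
    norm_num
    rw [Int.modEq_iff_dvd] at hzero ⊢
    obtain hj | ⟨q, hq, rfl⟩ | ⟨q, rfl⟩ := hcases j
    · rw [hodd j hj]
      have hj2 := Int.odd_iff.1 hj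
      rw [hκ0]
      omega
    · rw [htwo q hq]
      have hq2 := Int.odd_iff.1 hq
      obtain hc | hc := hχ q hq <;> rw [hc] <;> omega
    · have := hfour q
      rw [Int.modEq_iff_dvd] at this
      omega

end IsLayeredSpectrum

/-! ### The spectrum of the graph as a layered spectrum. -/

theorem evenCoeff_eq_zero_or_one (e : ℕ) (B : Finset ℕ) (a g : ℕ) :
    evenCoeff e B a g = 0 ∨ evenCoeff e B a g = 1 := by
  unfold evenCoeff
  split_ifs <;> simp

theorem evenCoeff_eq_one_iff {e : ℕ} {B : Finset ℕ} {a g : ℕ} :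
    evenCoeff e B a g = 1 ↔ a ≤ e ∧ 2 ^ (e - a) * g ∈ B := by
  unfold evenCoeff
  split_ifs with h <;> simp [h]

theorem oddCoeff_mem {e m : ℕ} {D : Finset ℕ} {σ : {d // d ∈ D} → ℤˣ} (hm : Odd m)
    {a g : ℕ} (hg : g ∣ m) :
    oddCoeff e m D σ a g = 0 ∨ oddCoeff e m D σ a g = 1 ∨ oddCoeff e m D σ a g = -1 := by
  have h2 := ZMod.χ₄_natCast_odd (hm.of_dvd_nat (Nat.div_dvd_of_dvd hg))
  unfold oddCoeff extendedSign
  split_ifs with h h1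
  · obtain h3 | h3 := Int.units_eq_one_or (σ ⟨_, h1⟩) <;>
      obtain h2 | h2 := h2 <;> simp [h2, h3]
  · simp
  · simp

theorem oddCoeff_eq_zero_iff {e m : ℕ} {D : Finset ℕ} {σ : {d // d ∈ D} → ℤˣ} (hm : Odd m)
    {a g : ℕ} (hg : g ∣ m) :
    oddCoeff e m D σ a g = 0 ↔ ¬ (a ≤ e ∧ 2 ^ (e - a) * g ∈ D) := by
  have h2 := ZMod.χ₄_natCast_odd (hm.of_dvd_nat (Nat.div_dvd_of_dvd hg))
  have h3 : ZMod.χ₄ ((m / g : ℕ) : ZMod 4) ≠ 0 := by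
    obtain h2 | h2 := h2 <;> rw [h2] <;> decide
  unfold oddCoeff
  split_ifs with h
  · rw [mul_eq_zero, or_iff_left h3, extendedSign_eq_zero_iff]
    simp [h]
  · simp [h]

section

variable {e m : ℕ} [NeZero (2 ^ e * m)] {B D : Finset ℕ} {σ : {d // d ∈ D} → ℤˣ}

theorem exists_isLayeredSpectrum_imcg (hm : Odd m) (hB : ∀ d ∈ B, d ∣ 2 ^ e * m ∧ d < 2 ^ e * m)
    (hD : ∀ d ∈ D, 4 ∣ 2 ^ e * m ∧ d ∣ 2 ^ e * m / 4) (hBD : Disjoint B D) :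
    ∃ F K Λ, IsLayeredSpectrum m (fun a x => evenCoeff e B a (Nat.gcd x m))
        (fun a x => oddCoeff e m D σ a (Nat.gcd x m)) F K Λ ∧
      ∀ j : ℤ, ∑ c, imcgCoeff (2 ^ e * m) B D σ c *
        ZMod.stdAddChar (c * (j : ZMod (2 ^ e * m))) = Λ j := by
  have hm0 := hm.pos.ne'
  choose F hF using fun a => exists_isFourierTransform_gcd hm0 (evenCoeff e B a)
  choose K hK using fun a => exists_isFourierTransform_gcd hm0 (oddCoeff e m D σ a)
  set f : ℤ → ℕ → ℤ := fun j b =>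
    ramanujanTwoPow b j * F (b + 1) j + twistedRamanujanTwoPow b j * K (b + 1) j with hf
  have hF0 : ∀ a, e < a → ∀ j, F a j = 0 := fun a ha j => by
    have h0 : ∀ g, evenCoeff e B a g = 0 := fun g => if_neg fun h => absurd h.1 (by omega)
    rw [(hF a).apply_eq_of_forall_pos hm0 (fun x _ _ => h0 _), h0]
  have hK0 : ∀ a, e < a ∨ a < 2 → ∀ j, K a j = 0 := fun a ha j => by
    have h0 : ∀ g, oddCoeff e m D σ a g = 0 := fun g => by
      obtain ha | ha := ha
      · exact if_neg (by omega)
      · exact oddCoeff_eq_zero hm hD ha g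
    rw [(hK a).apply_eq_of_forall_pos hm0 (fun x _ _ => h0 _), h0]
  -- Terms with index at least `e` vanish, so the split is valid even when `e < 3`.
  have hsplit : ∀ j, ∑ b ∈ Finset.range e, f j b =
      f j 0 + f j 1 + f j 2 + ∑ i ∈ Finset.range e, f j (3 + i) := by
    intro j
    have h1 := Finset.sum_range_add (f j) e 3
    have h2 := Finset.sum_range_add (f j) 3 e
    rw [Finset.sum_eq_zero (s := Finset.range 3), add_zero] at h1
    · rw [← h1, add_comm e 3, h2, Finset.sum_range_succ, Finset.sum_range_succ,
        Finset.sum_range_one]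
    · intro i _
      simp only [hf]
      rw [hF0 _ (by omega), hK0 _ (by omega)]
      ring
  have htail8 : ∀ j, 8 ∣ ∑ i ∈ Finset.range e, f j (3 + i) := fun j =>
    Finset.dvd_sum fun i _ => dvd_add
      ((eight_dvd_ramanujanTwoPow (by omega) j).mul_right _)
      ((eight_dvd_twistedRamanujanTwoPow (by omega) j).mul_right _)
  have htail0 : ∀ j : ℤ, ¬ 4 ∣ j → ∑ i ∈ Finset.range e, f j (3 + i) = 0 := fun j hj =>
    Finset.sum_eq_zero fun i _ => by
      simp only [hf]
      rw [ramanujanTwoPow_eq_zero (by omega) hj, twistedRamanujanTwoPow_eq_zero (by omega) hj]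
      ring
  refine ⟨F, K, fun j => F 0 j + ∑ b ∈ Finset.range e, f j b, ⟨hm, hF, hK,
    fun a x => evenCoeff_eq_zero_or_one _ _ _ _, fun a x => oddCoeff_mem hm (Nat.gcd_dvd_right _ _),
    ?_, ?_, ?_, ?_, ?_⟩, sum_imcgCoeff_mul_stdAddChar hm hD hF hK⟩
  · intro a x h
    rw [Ne, oddCoeff_eq_zero_iff hm (Nat.gcd_dvd_right _ _), not_not] at h
    exact if_neg fun h' => Finset.disjoint_left.1 hBD h'.2 h.2
  · refine if_neg fun h => ?_
    have := (hB _ h.2).2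
    simp at this
  · intro j hj
    have hj2 := Int.odd_iff.1 hj
    have h2 : ¬ (2 : ℤ) ∣ j := by omega
    have h4 : ¬ (4 : ℤ) ∣ j := by omega
    have h8 : ¬ (8 : ℤ) ∣ j := by omega
    simp only [hsplit, htail0 j h4]
    simp [hf, ramanujanTwoPow, twistedRamanujanTwoPow, h2, h4, h8, hK0 1 (by norm_num) j]
    ring
  · intro q hq
    have hq2 := Int.odd_iff.1 hq
    have h2 : (2 : ℤ) ∣ 2 * q := by omega
    have h4 : ¬ (4 : ℤ) ∣ 2 * q := by omega
    have h8 : ¬ (8 : ℤ) ∣ 2 * q := by omega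
    have hχ : ZMod.χ₄ ((2 * q : ℤ) : ZMod 4) = 0 := by
      rw [ZMod.χ₄_int_eq_if_mod_four, if_pos (by omega)]
    simp only [hsplit, htail0 _ h4]
    have hR0 : ramanujanTwoPow 0 (2 * q) = 1 := by simp [ramanujanTwoPow]
    have hR1 : ramanujanTwoPow 1 (2 * q) = -2 := by simp [ramanujanTwoPow, h4]
    have hR2 : ramanujanTwoPow 2 (2 * q) = 0 := by simp [ramanujanTwoPow, h4, h8]
    have hT1 : twistedRamanujanTwoPow 1 (2 * q) = 0 := by
      rw [twistedRamanujanTwoPow, Nat.sub_self, pow_zero, Int.ediv_one, hχ]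
      simp
    have hT2 : twistedRamanujanTwoPow 2 (2 * q) = -4 * ZMod.χ₄ (q : ZMod 4) := by
      simp [twistedRamanujanTwoPow]
    simp only [hf, hR0, hR1, hR2, hT1, hT2, hK0 (0 + 1) (by norm_num)]
    ring
  · intro q
    have h2 : (2 : ℤ) ∣ 4 * q := by omega
    have hχ : ZMod.χ₄ ((4 * q : ℤ) : ZMod 4) = 0 := by
      rw [ZMod.χ₄_int_eq_if_mod_four, if_pos (by omega)]
    have hχ' : ZMod.χ₄ ((4 * q / 2 : ℤ) : ZMod 4) = 0 := by
      rw [ZMod.χ₄_int_eq_if_mod_four, if_pos (by omega)]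
    obtain ⟨z, hz⟩ := htail8 (4 * q)
    simp only [hsplit, hz]
    have hR0 : ramanujanTwoPow 0 (4 * q) = 1 := by simp [ramanujanTwoPow, h2]
    have hR1 : ramanujanTwoPow 1 (4 * q) = 2 := by simp [ramanujanTwoPow]
    -- The sign depends on the parity of `q` but is irrelevant modulo 8.
    have hR2 : ramanujanTwoPow 2 (4 * q) = 4 ∨ ramanujanTwoPow 2 (4 * q) = -4 := by
      simp only [ramanujanTwoPow]
      norm_num
      omega
    have hT1 : twistedRamanujanTwoPow 1 (4 * q) = 0 := by
      rw [twistedRamanujanTwoPow, Nat.sub_self, pow_zero, Int.ediv_one, hχ]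
      simp
    have hT2 : twistedRamanujanTwoPow 2 (4 * q) = 0 := by
      rw [twistedRamanujanTwoPow, show (2 : ℤ) ^ (2 - 1) = 2 from rfl, hχ']
      simp
    simp only [hf, hR0, hR1, hT1, hT2, hK0 (0 + 1) (by norm_num), Int.modEq_iff_dvd]
    obtain hR2 | hR2 := hR2 <;> rw [hR2]
    · exact ⟨-z, by ring⟩
    · exact ⟨F 3 (4 * q) - z, by ring⟩

end

/-! ### Translation into statements about the sets of divisors. -/

theorem padicValNat_two_div {e m k g : ℕ} (hm : Odd m) (hk : k ≤ e) (hg : g ∣ m) :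
    padicValNat 2 (2 ^ e * m / (2 ^ k * g)) = e - k := by
  have hodd := hm.of_dvd_nat (Nat.div_dvd_of_dvd hg)
  have hg0 := Nat.pos_of_dvd_of_pos hg hm.pos
  have h1 : 2 ^ e * m / (2 ^ k * g) = 2 ^ (e - k) * (m / g) := by
    refine Nat.div_eq_of_eq_mul_right (by positivity) ?_
    have : 2 ^ e = 2 ^ k * 2 ^ (e - k) := by rw [← pow_add]; congr 1; omega
    rw [this]
    nth_rw 1 [← Nat.mul_div_cancel' hg]
    ring
  rw [h1, padicValNat.mul (by positivity) hodd.pos.ne', padicValNat.prime_pow,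
    padicValNat.eq_zero_of_not_dvd hodd.not_two_dvd_nat, add_zero]

theorem mem_layer_two_pow_mul_iff {e m : ℕ} (hm : Odd m) {A : Finset ℕ}
    (hA : ∀ d ∈ A, d ∣ 2 ^ e * m) {a : ℕ} (ha : a ≤ e) (d : ℕ) :
    d ∈ layer (2 ^ e * m) A a ↔ ∃ g, g ∣ m ∧ 2 ^ (e - a) * g ∈ A ∧ 2 ^ (e - a) * g = d := by
  rw [layer, Finset.mem_filter]
  constructor
  · rintro ⟨hd, hv⟩
    obtain ⟨y, g, hy, hg, rfl⟩ := Nat.dvd_mul.1 (hA d hd)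
    obtain ⟨k, hk, rfl⟩ := (Nat.dvd_prime_pow Nat.prime_two).1 hy
    rw [padicValNat_two_div hm hk hg] at hv
    obtain rfl : k = e - a := by omega
    exact ⟨g, hg, hd, rfl⟩
  · rintro ⟨g, hg, h, rfl⟩
    refine ⟨h, ?_⟩
    rw [padicValNat_two_div hm (Nat.sub_le _ _) hg]
    omega

/-- The divisors `g ≠ m` of `m` with `2 ^ k * g ∈ A`. -/
def properPart (m : ℕ) (A : Finset ℕ) (k : ℕ) : Finset ℕ :=
  m.divisors.filter fun g => g ≠ m ∧ 2 ^ k * g ∈ A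

theorem two_pow_mul_div_two_pow {e m a : ℕ} (ha : a ≤ e) :
    2 ^ e * m / 2 ^ a = 2 ^ (e - a) * m := by
  rw [← Nat.pow_div ha (by norm_num), Nat.div_mul_right_comm (pow_dvd_pow 2 ha)]

theorem layerStar_two_pow_mul {e m : ℕ} (hm : Odd m) {A : Finset ℕ}
    (hA : ∀ d ∈ A, d ∣ 2 ^ e * m) {a : ℕ} (ha : a ≤ e) :
    layerStar (2 ^ e * m) A a = dilate (2 ^ (e - a)) (properPart m A (e - a)) := by
  ext d
  rw [layerStar, Finset.mem_sdiff, mem_layer_two_pow_mul_iff hm hA ha, dilate, Finset.mem_image,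
    two_pow_mul_div_two_pow ha, Finset.mem_singleton]
  constructor
  · rintro ⟨⟨g, hg, h, rfl⟩, hne⟩
    exact ⟨g, Finset.mem_filter.2 ⟨Nat.mem_divisors.2 ⟨hg, hm.pos.ne'⟩, fun h' => hne (h' ▸ rfl), h⟩,
      rfl⟩
  · rintro ⟨g, hg, rfl⟩
    obtain ⟨hg, hne, h⟩ := Finset.mem_filter.1 hg
    exact ⟨⟨g, Nat.dvd_of_mem_divisors hg, h, rfl⟩,
      fun h' => hne (Nat.eq_of_mul_eq_mul_left (by positivity) h')⟩

theorem dilate_dilate (a b : ℕ) (A : Finset ℕ) : dilate a (dilate b A) = dilate (a * b) A := by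
  simp [dilate, Finset.image_image, Function.comp_def, mul_assoc]

theorem dilate_injective {a : ℕ} (ha : 0 < a) : Function.Injective (dilate a) :=
  Finset.image_injective fun _ _ h => Nat.eq_of_mul_eq_mul_left ha h

/-- No star is needed in layer 0: the element it would remove is `n`, which is not in `A`. -/
theorem layer_zero_two_pow_mul {e m : ℕ} (hm : Odd m) {A : Finset ℕ}
    (hA : ∀ d ∈ A, d ∣ 2 ^ e * m ∧ d < 2 ^ e * m) :
    layer (2 ^ e * m) A 0 = dilate (2 ^ e) (properPart m A e) := by
  rw [← Nat.sub_zero e, ← layerStar_two_pow_mul hm (fun d hd => (hA d hd).1) (Nat.zero_le e),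
    layerStar, Nat.sub_zero, pow_zero, Nat.div_one, Finset.sdiff_singleton_eq_erase,
    Finset.erase_eq_of_notMem]
  exact fun h => lt_irrefl _ (hA _ (Finset.mem_filter.1 h).1).2

theorem properPart_eq_iff {m : ℕ} (hm : m ≠ 0) (A : Finset ℕ) (k l : ℕ) :
    properPart m A k = properPart m A l ↔
      ∀ g, g ∣ m → g ≠ m → (2 ^ k * g ∈ A ↔ 2 ^ l * g ∈ A) := by
  rw [properPart, properPart, Finset.filter_inj']
  simp only [Nat.mem_divisors]
  refine forall_congr' fun g => ?_
  tauto

theorem layer_eq_empty_iff {e m : ℕ} (hm : Odd m) {A : Finset ℕ}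
    (hA : ∀ d ∈ A, d ∣ 2 ^ e * m) {a : ℕ} (ha : a ≤ e) :
    layer (2 ^ e * m) A a = ∅ ↔
      2 ^ (e - a) * m ∉ A ∧ ∀ g, g ∣ m → g ≠ m → 2 ^ (e - a) * g ∉ A := by
  simp only [Finset.eq_empty_iff_forall_notMem, mem_layer_two_pow_mul_iff hm hA ha]
  constructor
  · intro h
    exact ⟨fun h' => h _ ⟨m, dvd_rfl, h', rfl⟩, fun g hg _ h' => h _ ⟨g, hg, h', rfl⟩⟩
  · rintro ⟨h1, h2⟩ d ⟨g, hg, h, rfl⟩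
    by_cases hgm : g = m
    · exact h1 (hgm ▸ h)
    · exact h2 g hg hgm h

theorem layer_eq_singleton_iff {e m : ℕ} (hm : Odd m) {A : Finset ℕ}
    (hA : ∀ d ∈ A, d ∣ 2 ^ e * m) {a : ℕ} (ha : a ≤ e) :
    layer (2 ^ e * m) A a = {2 ^ (e - a) * m} ↔
      2 ^ (e - a) * m ∈ A ∧ ∀ g, g ∣ m → g ≠ m → 2 ^ (e - a) * g ∉ A := by
  simp only [Finset.ext_iff, Finset.mem_singleton, mem_layer_two_pow_mul_iff hm hA ha]
  constructor
  · intro h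
    refine ⟨?_, fun g hg hne h' => ?_⟩
    · obtain ⟨g, -, h1, h2⟩ := (h _).2 rfl
      exact h2 ▸ h1
    · exact hne (Nat.eq_of_mul_eq_mul_left (by positivity) ((h _).1 ⟨g, hg, h', rfl⟩))
  · rintro ⟨h1, h2⟩ d
    constructor
    · rintro ⟨g, hg, h, rfl⟩
      by_contra hne
      exact h2 g hg (fun h' => hne (h' ▸ rfl)) h
    · rintro rfl
      exact ⟨m, dvd_rfl, h1, rfl⟩

/-- As `x` runs through `0 < x < m`, its gcd with `m` runs through the proper divisors; `x = 0`
gives `m`, the element that the star removes. -/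
theorem forall_gcd_iff {m : ℕ} (hm : m ≠ 0) (P : ℕ → Prop) :
    (∀ x, 0 < x → x < m → P (Nat.gcd x m)) ↔ ∀ g, g ∣ m → g ≠ m → P g := by
  constructor
  · intro h g hg hne
    have h1 := h g (Nat.pos_of_dvd_of_pos hg (Nat.pos_of_ne_zero hm))
      (lt_of_le_of_ne (Nat.le_of_dvd (Nat.pos_of_ne_zero hm) hg) hne)
    rwa [Nat.gcd_eq_left hg] at h1
  · intro h x hx0 hx
    refine h _ (Nat.gcd_dvd_right _ _) fun h' => ?_
    have := Nat.le_of_dvd hx0 (Nat.gcd_eq_right_iff_dvd.1 h')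
    omega

theorem forall_hasPST_imcg_iff {e m : ℕ} [NeZero (2 ^ e * m)] (he : e ≠ 0) (hm : Odd m)
    {B D : Finset ℕ} (σ : {d // d ∈ D} → ℤˣ)
    (hB : ∀ d ∈ B, d ∣ 2 ^ e * m ∧ d < 2 ^ e * m)
    (hD : ∀ d ∈ D, 4 ∣ 2 ^ e * m ∧ d ∣ 2 ^ e * m / 4) (hBD : Disjoint B D) :
    (∀ b : ZMod (2 ^ e * m), (imcg (2 ^ e * m) B D σ).HasPST
        (b + ((2 ^ e * m / 2 : ℕ) : ZMod (2 ^ e * m))) b) ↔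
      LayerCondition m (fun a x => evenCoeff e B a (Nat.gcd x m))
        (fun a x => oddCoeff e m D σ a (Nat.gcd x m)) := by
  obtain ⟨F, K, Λ, S, hΛ⟩ := exists_isLayeredSpectrum_imcg (σ := σ) hm hB hD hBD
  have hn : Even (2 ^ e * m) := ((Nat.even_pow' he).2 even_two).mul_right m
  rw [forall_hasPST_iff hn _ _ (hermitianAdj_imcg hB hD hBD) Λ hΛ, exists_time_iff]
  exact ⟨fun ⟨v, hv⟩ => S.layerCondition_of_phase hv, S.phase_of_layerCondition⟩

/-- The right-hand side of the characterization, in terms of the divisors of the odd part `m`. -/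
theorem layerCondition_imcg_iff {e m : ℕ} (he : 2 ≤ e) (hm : Odd m) {B D : Finset ℕ}
    (σ : {d // d ∈ D} → ℤˣ) :
    LayerCondition m (fun a x => evenCoeff e B a (Nat.gcd x m))
        (fun a x => oddCoeff e m D σ a (Nat.gcd x m)) ↔
      (∀ g, g ∣ m → g ≠ m → (2 ^ e * g ∈ B ↔ 2 ^ (e - 1) * g ∈ B) ∧
        (2 ^ (e - 1) * g ∈ B ↔ 2 ^ (e - 2) * g ∈ B) ∧ 2 ^ (e - 2) * g ∉ D) ∧
      ((2 ^ (e - 2) * m ∈ D ∧ 2 ^ (e - 1) * m ∉ B) ∨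
        (2 ^ (e - 2) * m ∉ D ∧ ¬ (2 ^ (e - 1) * m ∈ B ↔ 2 ^ (e - 2) * m ∈ B)) ∨
        (2 ^ (e - 2) * m ∉ D ∧ 2 ^ (e - 1) * m ∈ B ∧ 2 ^ (e - 2) * m ∈ B ∧
          (3 ≤ e ∧ 2 ^ (e - 3) * m ∈ D) ∧ ∀ g, g ∣ m → g ≠ m → 2 ^ (e - 3) * g ∉ D ∧
            (2 ^ (e - 2) * g ∈ B ↔ 2 ^ (e - 3) * g ∈ B))) := by
  have hm0 := hm.pos.ne'
  have heq : ∀ a a' g, evenCoeff e B a g = evenCoeff e B a' g ↔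
      (a ≤ e ∧ 2 ^ (e - a) * g ∈ B ↔ a' ≤ e ∧ 2 ^ (e - a') * g ∈ B) := by
    intro a a' g
    rw [← evenCoeff_eq_one_iff, ← evenCoeff_eq_one_iff]
    have := evenCoeff_eq_zero_or_one e B a g
    have := evenCoeff_eq_zero_or_one e B a' g
    omega
  have hzero : ∀ a g, evenCoeff e B a g = 0 ↔ ¬ (a ≤ e ∧ 2 ^ (e - a) * g ∈ B) := by
    intro a g
    rw [← evenCoeff_eq_one_iff]
    have := evenCoeff_eq_zero_or_one e B a g
    omega
  have hodd : ∀ a {g}, g ∣ m → (oddCoeff e m D σ a g = 0 ↔ ¬ (a ≤ e ∧ 2 ^ (e - a) * g ∈ D)) :=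
    fun a g hg => oddCoeff_eq_zero_iff hm hg
  have he1 : 1 ≤ e := by omega
  rw [LayerCondition, forall_gcd_iff hm0 fun g => evenCoeff e B 0 g = evenCoeff e B 1 g ∧
    evenCoeff e B 1 g = evenCoeff e B 2 g ∧ oddCoeff e m D σ 2 g = 0,
    forall_gcd_iff hm0 fun g => oddCoeff e m D σ 3 g = 0 ∧ evenCoeff e B 2 g = evenCoeff e B 3 g]
  simp only [Nat.gcd_zero_left, Ne, evenCoeff_eq_one_iff, heq, hzero, hodd _ dvd_rfl, he, he1,
    true_and, Nat.zero_le, Nat.sub_zero, not_not]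
  refine and_congr ?_ (or_congr Iff.rfl (or_congr Iff.rfl ?_))
  · refine forall_congr' fun g => forall_congr' fun hg => ?_
    rw [hodd _ hg]
    simp only [he, true_and]
  · refine and_congr_right fun _ => and_congr_right fun _ => and_congr_right fun _ =>
      and_congr_right fun h => ?_
    refine forall_congr' fun g => forall_congr' fun hg => ?_
    rw [hodd _ hg]
    simp only [h.1, true_and]

/-- For `n = 2m` layers 2 and above are empty. Hence layers 0 and 1 vanish away from `x = 0`, and
only the alternative `b 1 0 ≠ b 2 0` remains, which puts `n/2` in `B`. -/
theorem eq_half_of_layerCondition {m : ℕ} (hm : Odd m) {B D : Finset ℕ}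
    (σ : {d // d ∈ D} → ℤˣ) (hB : ∀ d ∈ B, d ∣ 2 ^ 1 * m ∧ d < 2 ^ 1 * m)
    (h : LayerCondition m (fun a x => evenCoeff 1 B a (Nat.gcd x m))
        (fun a x => oddCoeff 1 m D σ a (Nat.gcd x m))) : B = {m} := by
  have hm0 := hm.pos.ne'
  have h2 : ∀ a g, 2 ≤ a → evenCoeff 1 B a g = 0 := fun a g ha => if_neg fun h => by omega
  have h2' : ∀ a g, 2 ≤ a → oddCoeff 1 m D σ a g = 0 := fun a g ha => if_neg (by omega)
  obtain ⟨h1, h3⟩ := h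
  rw [forall_gcd_iff hm0 fun g => evenCoeff 1 B 0 g = evenCoeff 1 B 1 g ∧
    evenCoeff 1 B 1 g = evenCoeff 1 B 2 g ∧ oddCoeff 1 m D σ 2 g = 0] at h1
  simp only [Nat.gcd_zero_left, h2 2 _ le_rfl, h2' 2 _ le_rfl, h2 3 _ (by norm_num)] at h1 h3
  have hmB : m ∈ B := by
    have h4 := evenCoeff_eq_zero_or_one 1 B 1 m
    have h5 : evenCoeff 1 B 1 m = 1 := by omega
    simpa using (evenCoeff_eq_one_iff.1 h5).2
  refine Finset.eq_singleton_iff_unique_mem.2 ⟨hmB, fun d hd => ?_⟩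
  by_contra hne
  obtain ⟨hdvd, hlt⟩ := hB d hd
  obtain ⟨y, g, hy, hg, rfl⟩ := Nat.dvd_mul.1 hdvd
  obtain ⟨k, hk, rfl⟩ := (Nat.dvd_prime_pow Nat.prime_two).1 hy
  have hgm : g ≠ m := by
    rintro rfl
    interval_cases k
    · simp at hne
    · simp at hlt
  obtain ⟨h5, h6, -⟩ := h1 g hg hgm
  have h7 : evenCoeff 1 B (1 - k) g = 1 :=
    evenCoeff_eq_one_iff.2 ⟨by omega, by rwa [show 1 - (1 - k) = k by omega]⟩
  interval_cases k <;> norm_num at h7 <;> omega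

theorem theorem1p2 (n : ℕ) [NeZero n] (B D : Finset ℕ) (σ : {d // d ∈ D} → ℤˣ)
    (hB : ∀ d ∈ B, d ∣ n ∧ d < n) (hD : ∀ d ∈ D, 4 ∣ n ∧ d ∣ n / 4) (hBD : Disjoint B D)
    (hmatching : ¬ (n % 4 = 2 ∧ B = {n / 2})) :
    (Even n ∧ ∀ b : ZMod n, (imcg n B D σ).HasPST (b + ((n / 2 : ℕ) : ZMod n)) b) ↔
      ((layer n B 0 = dilate 2 (layerStar n B 1) ∧
          dilate 2 (layerStar n B 1) = dilate 4 (layerStar n B 2)) ∧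
        ((4 ∣ n ∧ layer n D 2 = {n / 4} ∧ n / 2 ∉ B) ∨
          (4 ∣ n ∧ layer n D 2 = ∅ ∧ Xor (n / 2 ∈ B) (n / 4 ∈ B)) ∨
          (8 ∣ n ∧ layer n D 2 = ∅ ∧ (n / 4 ∈ B ∧ n / 2 ∈ B) ∧ layer n D 3 = {n / 8} ∧
            layerStar n B 2 = dilate 2 (layerStar n B 3)))) := by
  obtain ⟨e, m, hm', rfl⟩ := Nat.exists_eq_pow_mul_and_not_dvd (NeZero.ne n) 2 (by norm_num)
  have hm : Odd m := Nat.not_even_iff_odd.1 fun h => hm' (even_iff_two_dvd.1 h)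
  by_cases he : 2 ≤ e
  · have hn : Even (2 ^ e * m) := ((Nat.even_pow' (by omega)).2 even_two).mul_right m
    have hm0 := hm.pos.ne'
    have hB' : ∀ d ∈ B, d ∣ 2 ^ e * m := fun d hd => (hB d hd).1
    have hD' : ∀ d ∈ D, d ∣ 2 ^ e * m := fun d hd =>
      (dvd_mul_left d 4).trans (four_mul_dvd_of_mem hD hd)
    have h4 : 4 ∣ 2 ^ e * m := (pow_dvd_pow 2 he).mul_right m
    have h8 : 8 ∣ 2 ^ e * m ↔ 3 ≤ e := by
      rw [show 8 = 2 ^ 3 from rfl,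
        Nat.Coprime.dvd_mul_right (Nat.Coprime.pow_left _ hm.coprime_two_left),
        Nat.pow_dvd_pow_iff_le_right (by norm_num)]
    have hd1 : 2 ^ e * m / 2 = 2 ^ (e - 1) * m := two_pow_mul_div_two_pow (by omega : 1 ≤ e)
    have hd2 : 2 ^ e * m / 4 = 2 ^ (e - 2) * m := two_pow_mul_div_two_pow he
    have hs1 : dilate 2 (layerStar (2 ^ e * m) B 1) = dilate (2 ^ e) (properPart m B (e - 1)) := by
      rw [layerStar_two_pow_mul hm hB' (by omega), dilate_dilate, ← pow_succ']
      congr 2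
      omega
    have hs2 : dilate 4 (layerStar (2 ^ e * m) B 2) = dilate (2 ^ e) (properPart m B (e - 2)) := by
      rw [layerStar_two_pow_mul hm hB' he, dilate_dilate, show 4 = 2 ^ 2 from rfl, ← pow_add]
      congr 2
      omega
    have hs3 : 3 ≤ e → (layerStar (2 ^ e * m) B 2 = dilate 2 (layerStar (2 ^ e * m) B 3) ↔
        ∀ g, g ∣ m → g ≠ m → (2 ^ (e - 2) * g ∈ B ↔ 2 ^ (e - 3) * g ∈ B)) := by
      intro he3
      rw [layerStar_two_pow_mul hm hB' he, layerStar_two_pow_mul hm hB' he3, dilate_dilate,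
        ← pow_succ', show e - 3 + 1 = e - 2 by omega,
        (dilate_injective (by positivity)).eq_iff, properPart_eq_iff hm0]
    have hl3 : 3 ≤ e → (layer (2 ^ e * m) D 3 = {2 ^ e * m / 8} ↔
        2 ^ (e - 3) * m ∈ D ∧ ∀ g, g ∣ m → g ≠ m → 2 ^ (e - 3) * g ∉ D) := by
      intro he3
      rw [show 2 ^ e * m / 8 = 2 ^ (e - 3) * m from two_pow_mul_div_two_pow he3,
        layer_eq_singleton_iff hm hD' he3]
    rw [and_iff_right hn, forall_hasPST_imcg_iff (by omega) hm σ hB hD hBD,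
      layerCondition_imcg_iff he hm σ, hd1, hd2, h8, layer_zero_two_pow_mul hm hB, hs1, hs2,
      (dilate_injective (by positivity)).eq_iff, (dilate_injective (by positivity)).eq_iff,
      properPart_eq_iff hm0, properPart_eq_iff hm0, layer_eq_singleton_iff hm hD' he,
      layer_eq_empty_iff hm hD' he]
    simp only [h4, true_and, Xor]
    -- The absence of proper divisors from `D_2` is a common clause on the left; on the right it is
    -- contained in each description of `D_2`.
    constructor
    · rintro ⟨h, hc⟩
      refine ⟨⟨fun g hg hne => (h g hg hne).1, fun g hg hne => (h g hg hne).2.1⟩, ?_⟩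
      have hY : ∀ g, g ∣ m → g ≠ m → 2 ^ (e - 2) * g ∉ D := fun g hg hne => (h g hg hne).2.2
      obtain ⟨h1, h2⟩ | ⟨h1, h2⟩ | ⟨h1, h2, h3, ⟨he3, h5⟩, h6⟩ := hc
      · exact Or.inl ⟨⟨h1, hY⟩, h2⟩
      · exact Or.inr (Or.inl ⟨⟨h1, hY⟩, by tauto⟩)
      · exact Or.inr (Or.inr ⟨he3, ⟨h1, hY⟩, ⟨h3, h2⟩,
          (hl3 he3).2 ⟨h5, fun g hg hne => (h6 g hg hne).1⟩,
          (hs3 he3).2 fun g hg hne => (h6 g hg hne).2⟩)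
    · rintro ⟨⟨h01, h12⟩, hc⟩
      obtain ⟨⟨h1, hY⟩, h2⟩ | ⟨⟨h1, hY⟩, h2⟩ | ⟨he3, ⟨h1, hY⟩, ⟨h3, h2⟩, h5, h6⟩ := hc
      · exact ⟨fun g hg hne => ⟨h01 g hg hne, h12 g hg hne, hY g hg hne⟩, Or.inl ⟨h1, h2⟩⟩
      · exact ⟨fun g hg hne => ⟨h01 g hg hne, h12 g hg hne, hY g hg hne⟩,
          Or.inr (Or.inl ⟨h1, by tauto⟩)⟩
      · obtain ⟨h5, h7⟩ := (hl3 he3).1 h5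
        exact ⟨fun g hg hne => ⟨h01 g hg hne, h12 g hg hne, hY g hg hne⟩,
          Or.inr (Or.inr ⟨h1, h2, h3, ⟨he3, h5⟩,
            fun g hg hne => ⟨h7 g hg hne, (hs3 he3).1 h6 g hg hne⟩⟩)⟩
  · have hodd2 := Nat.odd_iff.1 hm
    have h4 : ¬ 4 ∣ 2 ^ e * m := by
      obtain rfl | rfl : e = 0 ∨ e = 1 := by omega
      · omega
      · omega
    -- Every alternative on the right needs `4 ∣ n`; on the left `e = 0` contradicts evenness and `e
    -- = 1` leads to the excluded matching.
    refine iff_of_false ?_ ?_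
    · rintro ⟨hn, h⟩
      have he0 : e ≠ 0 := by
        rintro rfl
        rw [pow_zero, one_mul] at hn
        exact Nat.not_even_iff_odd.2 hm hn
      rw [forall_hasPST_imcg_iff he0 hm σ hB hD hBD] at h
      obtain rfl : e = 1 := by omega
      refine hmatching ⟨by omega, ?_⟩
      rw [eq_half_of_layerCondition hm σ hB h, pow_one, Nat.mul_div_cancel_left _ (by norm_num)]
    · rintro ⟨-, ⟨h, -⟩ | ⟨h, -⟩ | ⟨h, -⟩⟩
      · exact h4 h
      · exact h4 h
      · exact h4 ((by norm_num : 4 ∣ 8).trans h)
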